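/- Haar notation: let $\psi=-1_{(0,1/2]}+1_{(1/2,1]}$, $\psi_{lk}(x)=2^{l/2}\psi(2^lx-k)$ and $f_{lk}=\int_0^1 f\psi_{lk}$ for $l\ge 0$, $0\le k<2^l$. For $\alpha,R,m_0,m_1>0$ let $\mathcal H(\alpha,R)=\{f:\ |f_{lk}|\le R\,2^{-l(\alpha+1/2)}\ \text{for all } l\ge 0,\ 0\le k<2^l\}$ and $\mathcal F(m_0,m_1)=\{f:\ \int_0^1 f=1,\ m_0\le f\le m_1 \text{ on } [0,1]\}$. Prior: for $n\ge1$ let $L=L_n$ be the largest integer $L\le\log_2 n$ with $2^LL^2\le n$. For a finite binary word $\varepsilon=\varepsilon_1\ldots\varepsilon_l$ of length $|\varepsilon|=l$, with $k2^{-l}=\sum_{i}\varepsilon_i2^{-i}$, let $I_\varepsilon=(k2^{-l},(k+1)2^{-l}]$. Given an integer $a\ge1$ and $\kappa\in\mathbb R$, put $\pi_\varepsilon=e^{-\kappa |\varepsilon|}/\sum_{j=0}^{L}e^{-\kappa j}$; let $Y_{\varepsilon0}$, $|\varepsilon|<L$, be independent with $Y_{\varepsilon0}\sim(1-\pi_{\varepsilon0})\delta_{1/2}+\pi_{\varepsilon0}\,\mathrm{Beta}(a,a)$,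 and $Y_{\varepsilon1}=1-Y_{\varepsilon0}$. The Spike and Slab Pólya tree prior $\Pi=\Pi_n$ with $\alpha_\varepsilon=a$ and these weights $\pi_\varepsilon$ is the law of the random histogram density $f$ equal to $2^L\prod_{j=1}^{L}Y_{\varepsilon_1\ldots\varepsilon_j}$ on $I_\varepsilon$ for each $\varepsilon$ with $|\varepsilon|=L$. Let $\Pi[\,\cdot\,|\,X]$ be the posterior distribution of $f$ in the model $f\sim\Pi_n$, $X=(X_1,\ldots,X_n)\,|\,f$ i.i.d. with density $f$ on $[0,1]$. Theorem. For all $m_0,m_1>0$ there is a constant $\kappa_0=\kappa_0(m_0,m_1)$ such that for every $\kappa\ge\kappa_0$, every integer $a\ge1$, every $\alpha\in(0,1]$ and every $R>0$ there is $M_0=M_0(\alpha,R,m_0,m_1,a,\kappa)$ such that for every $M\ge M_0$ and every $f_0\in\mathcal H(\alpha,R)\cap\mathcal F(m_0,m_1)$: if $X_1,X_2,\ldots$ are i.i.d. with density $f_0$ on $[0,1]$, then, as $n\to\infty$, $$\Pi\Big[\ \|f-f_0\|_\infty\le M\Big(\frac{\log n}{n}\Big)^{\frac{\alpha}{2\alpha+1}}\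 \Big|\ X_1,\ldots,X_n\Big]\longrightarrow 1\quad\text{in } P_{f_0}\text{-probability},$$ where $\|\cdot\|_\infty$ is the (essential) supremum norm on $[0,1]$. -/

import Mathlib

open MeasureTheory ProbabilityTheory Filter
open scoped ENNReal Topology

noncomputable section

namespace SpikeSlab

/-! ### Haar wavelets and function classes on the unit interval -/

/-- Lebesgue measure on the unit interval. -/
def lebUnit : Measure ℝ := volume.restrict (Set.Icc (0 : ℝ) 1)

/-- The mother Haar wavelet `ψ = -1_{(0,1/2]} + 1_{(1/2,1]}`. -/
def haarMother (x : ℝ) : ℝ :=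
  -(Set.Ioc (0 : ℝ) (1 / 2)).indicator (fun _ => (1 : ℝ)) x
    + (Set.Ioc (1 / 2 : ℝ) 1).indicator (fun _ => (1 : ℝ)) x

/-- The Haar wavelet `ψ_{lk}(x) = 2^{l/2} ψ(2^l x - k)`. -/
def haar (l k : ℕ) (x : ℝ) : ℝ :=
  (2 : ℝ) ^ ((l : ℝ) / 2) * haarMother ((2 : ℝ) ^ l * x - k)

/-- The Haar coefficient `f_{lk} = ∫_0^1 f ψ_{lk}`. -/
def haarCoeff (f : ℝ → ℝ) (l k : ℕ) : ℝ := ∫ x, f x * haar l k x ∂lebUnit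

/-- The Hölder-type ball `H(α,R)`: `|f_{lk}| ≤ R 2^{-l(α+1/2)}` for all `l ≥ 0`, `0 ≤ k < 2^l`. -/
def HolderBall (α R : ℝ) : Set (ℝ → ℝ) :=
  {f | ∀ l k : ℕ, k < 2 ^ l →
    |haarCoeff f l k| ≤ R * (2 : ℝ) ^ (-((l : ℝ) * (α + 1 / 2)))}

/-- The class `F(m₀,m₁)` of probability densities on `[0,1]` with `m₀ ≤ f ≤ m₁`
(Lebesgue-almost everywhere; functions on `[0,1]` are represented by functions on `ℝ` whose values
outside `[0,1]` are never used). -/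
def BoundedDensities (m₀ m₁ : ℝ) : Set (ℝ → ℝ) :=
  {f | Integrable f lebUnit ∧ ∫ x, f x ∂lebUnit = 1 ∧ ∀ᵐ x ∂lebUnit, m₀ ≤ f x ∧ f x ≤ m₁}

/-- The distribution `P_f` on `[0,1]` with Lebesgue density `f`. -/
def densityLaw (f : ℝ → ℝ) : Measure ℝ := lebUnit.withDensity (fun x => ENNReal.ofReal (f x))

/-- The (essential) supremum norm of `g` on `[0,1]`. -/
def supNorm (g : ℝ → ℝ) : ℝ≥0∞ := eLpNorm g ∞ lebUnit

/-! ### Truncated tree priors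

The binary word `ε` of length `l` with `k 2^{-l} = ∑ ε_i 2^{-i}` is encoded by the pair `(l, k)`, so
that `ε0` and `ε1` are `(l + 1, 2 k)` and `(l + 1, 2 k + 1)`. -/

/-- The dyadic interval `I_ε = (k 2^{-l}, (k+1) 2^{-l}]`. -/
def dyadic (l k : ℕ) : Set ℝ := Set.Ioc ((k : ℝ) / 2 ^ l) (((k : ℝ) + 1) / 2 ^ l)

/-- The words `ε = (l, k)` with `|ε| = l < L`. -/
abbrev Node (L : ℕ) : Type := Σ l : Fin L, Fin (2 ^ (l : ℕ))

/-- The variable `Y_{ε0}` for `ε = (l, k)`; `y ε` stands for `Y_{ε0}`, `|ε| < L`, and all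
splits below depth `L` are even. -/
def splitVar {L : ℕ} (y : Node L → ℝ) (l k : ℕ) : ℝ :=
  if h : l < L ∧ k < 2 ^ l then y ⟨⟨l, h.1⟩, ⟨k, h.2⟩⟩ else 1 / 2

/-- The mass `P(I_ε) = ∏_j Y_{ε_1…ε_j}`, where `Y_{ε1} = 1 - Y_{ε0}`. -/
def treeMass {L : ℕ} (y : Node L → ℝ) : ℕ → ℕ → ℝ
  | 0, _ => 1
  | l + 1, k => treeMass y l (k / 2) *
      (if k % 2 = 0 then splitVar y l (k / 2) else 1 - splitVar y l (k / 2))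

/-- The histogram density with height `2^L P(I_ε)` on `I_ε`, `|ε| = L`. -/
def treeDensity {L : ℕ} (y : Node L → ℝ) (x : ℝ) : ℝ :=
  ∑ k ∈ Finset.range (2 ^ L),
    (dyadic L k).indicator (fun _ => (2 : ℝ) ^ L * treeMass y L k) x

/-! ### Spike and Slab Pólya trees -/

/-- The law `(1 - p) δ_{1/2} + p Beta(a, b)`. -/
def spikeSlabLaw (p a b : ℝ) : Measure ℝ :=
  ENNReal.ofReal (1 - p) • Measure.dirac (1 / 2) + ENNReal.ofReal p • betaMeasure a b

/-- The Spike and Slab Pólya tree `Π(α_ε, π_ε)` truncated at `L`, as the law of the independent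
variables `Y_{ε0} ∼ (1 - π_{ε0}) δ_{1/2} + π_{ε0} Beta(α_{ε0}, α_{ε1})`, `|ε| < L`.
Here `A l k` and `w l k` are `α_ε` and `π_ε` for the word `ε = (l, k)`. -/
def spikeSlabTree (L : ℕ) (A w : ℕ → ℕ → ℝ) : Measure (Node L → ℝ) :=
  Measure.pi fun e : Node L =>
    spikeSlabLaw (w (e.1 + 1) (2 * e.2)) (A (e.1 + 1) (2 * e.2)) (A (e.1 + 1) (2 * e.2 + 1))

/-- The cutoff: the largest integer `L ≤ log₂ n` such that `2^L L^2 ≤ n`. -/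
def cutoff (n : ℕ) : ℕ := Nat.findGreatest (fun L => 2 ^ L * L ^ 2 ≤ n) (Nat.log 2 n)

/-- The weights `π_ε = e^{-κ l} / ∑_{j=0}^L e^{-κ j}`, `l = |ε|`. -/
def expWeight (κ : ℝ) (L l : ℕ) : ℝ :=
  Real.exp (-κ * l) / ∑ j ∈ Finset.range (L + 1), Real.exp (-κ * j)

/-- The prior for sample size `n`: the Spike and Slab Pólya tree with `α_ε = a` and exponentially
decreasing weights. -/
def prior (a : ℕ) (κ : ℝ) (n : ℕ) : Measure (Node (cutoff n) → ℝ) :=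
  spikeSlabTree (cutoff n) (fun _ _ => (a : ℝ)) (fun l _ => expWeight κ (cutoff n) l)

/-! ### Posterior distribution -/

/-- The likelihood `∏_i f(X_i)` of a sample of size `n` under the histogram density of `y`. -/
def likelihood {L n : ℕ} (x : Fin n → ℝ) (y : Node L → ℝ) : ℝ≥0∞ :=
  ∏ i, ENNReal.ofReal (treeDensity y (x i))

/-- The posterior distribution given the sample `x`, by Bayes' formula
`Π[B | X] = ∫_B ∏ f(X_i) dΠ(f) / ∫ ∏ f(X_i) dΠ(f)`. -/
def bayesPosterior {L n : ℕ} (Q : Measure (Node L → ℝ)) (x : Fin n → ℝ) : Measure (Node L → ℝ) :=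
  (∫⁻ y, likelihood x y ∂Q)⁻¹ • Q.withDensity (likelihood x)

/-- The posterior probability `Π[‖f - f₀‖_∞ ≤ r | X]`, where `f` is the random histogram density
induced by the tree variables. -/
def posteriorBall (a : ℕ) (κ : ℝ) (n : ℕ) (f₀ : ℝ → ℝ) (r : ℝ) (x : Fin n → ℝ) : ℝ :=
  (bayesPosterior (prior a κ n) x).real
    {y | supNorm (fun t => treeDensity y t - f₀ t) ≤ ENNReal.ofReal r}

/-- The rate `(log n / n)^{α/(2α+1)}`. -/
def rate (α : ℝ) (n : ℕ) : ℝ := (Real.log n / n) ^ (α / (2 * α + 1))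

end SpikeSlab

end

open MeasureTheory ProbabilityTheory Filter
open scoped ENNReal Topology

noncomputable section

namespace SpikeSlab

/-! The dyadic likelihood is a product over nodes of binomial likelihoods `splitLik`, and the prior
makes the splits independent, so the posterior is a product of one-dimensional posteriors
(`likelihood_eq_prod`, `one_sub_le_bayesPosterior_real`). It is then enough to control each split
with posterior error `1/n^2`: there are fewer than `n` nodes, and a union bound costs only `1/n`.

Fix a level `J` with `2^J` of order `(n / log n)^(1/(2α+1))`. Below `J` the binomial likelihood
falls off like a Gaussian around the empirical proportion, so the split lies within `δ_l = √(Γ 2^l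
log n / n)` of the true conditional mass (`setLIntegral_far_le`). From `J` on, moving from `1/2` to
the best split gains at most `exp((a-b)^2/(a+b))` in likelihood. The Haar decay of `f₀` and the
concentration of the counts make this a power of `n` whose exponent depends only on `m₀, m₁`. The
prior odds of the slab are at most `e^{-κ l}` with `l ≥ log n / 4`, so a large `κ` forces the split
to equal `1/2` (`setLIntegral_spike_compl_le`).

If all splits behave this way, `f` is a histogram at level `J`. Its relative errors add up along a
branch to `∑_{l<J} δ_l`, a geometric sum of order `√(2^J log n / n)`, and the bias is of order
`2^{-αJ}` (`supNorm_treeDensity_sub_le`); both are of the order of the rate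
(`eventually_exists_level`). The randomness of the data enters only through the counts, which are
close to their means at all levels with probability at least `1 - 4/n`
(`measureReal_not_regularSample_le`). -/

/-! ### The binomial likelihood of a split -/

/-- The likelihood `y^a (1-y)^b` of a split with `a` observations to the left and `b` to the
right. -/
def splitLik (a b : ℕ) (y : ℝ) : ℝ := y ^ a * (1 - y) ^ b

lemma measurable_splitLik (a b : ℕ) : Measurable (splitLik a b) := by
  unfold splitLik; fun_prop

lemma splitLik_nonneg (a b : ℕ) {y : ℝ} (h0 : 0 ≤ y) (h1 : y ≤ 1) : 0 ≤ splitLik a b y :=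
  mul_nonneg (pow_nonneg h0 _) (pow_nonneg (by linarith) _)

lemma splitLik_half (a b : ℕ) : splitLik a b (1 / 2) = (1 / 2) ^ (a + b) := by
  unfold splitLik; rw [pow_add]; norm_num

/-- This is `t ≤ e^{t-1}` at `t = √(y/p)`, raised to the power `2a`. With `t = y/p` the exponents of
the two sides of a split would cancel at `p = a/(a+b)`; the square root leaves the Hellinger
affinity, which is quadratic in `y - p`. -/
lemma pow_le_mul_exp_sqrt (a : ℕ) {y p : ℝ} (hy : 0 ≤ y) (hp : 0 < p) :
    y ^ a ≤ p ^ a * Real.exp (2 * a * (√(y / p) - 1)) := by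
  have h1 : y = p * √(y / p) ^ 2 := by
    rw [Real.sq_sqrt (by positivity)]; field_simp
  have h2 : √(y / p) ≤ Real.exp (√(y / p) - 1) := by
    have := Real.add_one_le_exp (√(y / p) - 1); linarith
  calc y ^ a = p ^ a * √(y / p) ^ (2 * a) := by
        conv_lhs => rw [h1]
        rw [mul_pow, pow_mul]
    _ ≤ p ^ a * Real.exp (√(y / p) - 1) ^ (2 * a) := by gcongr
    _ = _ := by rw [← Real.exp_nat_mul]; push_cast; ring_nf

/-- Hellinger affinity bound for Bernoulli distributions. -/
lemma sqrt_mul_add_sqrt_mul_le {p y : ℝ} (hp0 : 0 ≤ p) (hp1 : p ≤ 1) (hy0 : 0 ≤ y) (hy1 : y ≤ 1) :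
    √p * √y + √(1 - p) * √(1 - y) ≤ 1 - (y - p) ^ 2 / 4 := by
  have key : ∀ s t : ℝ, 0 ≤ s → s ≤ 1 → 0 ≤ t → t ≤ 1 →
      (t - s) ^ 2 ≤ 4 * (√t - √s) ^ 2 := by
    intro s t hs hs1 ht ht1
    have e1 := Real.sq_sqrt hs
    have e2 := Real.sq_sqrt ht
    have b1 : √s ≤ 1 := Real.sqrt_le_one.2 hs1
    have b2 : √t ≤ 1 := Real.sqrt_le_one.2 ht1
    have : t - s = (√t - √s) * (√t + √s) := by ring_nf; rw [e1, e2]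
    rw [this, mul_pow, mul_comm]
    have : (√t + √s) ^ 2 ≤ 4 := by nlinarith [Real.sqrt_nonneg s, Real.sqrt_nonneg t]
    gcongr
  have k1 := key p y hp0 hp1 hy0 hy1
  have k2 := key (1 - p) (1 - y) (by linarith) (by linarith) (by linarith) (by linarith)
  have e1 := Real.sq_sqrt hp0
  have e2 := Real.sq_sqrt hy0
  have e3 := Real.sq_sqrt (show 0 ≤ 1 - p by linarith)
  have e4 := Real.sq_sqrt (show 0 ≤ 1 - y by linarith)
  -- The affinity is one minus half the sum of the two squared differences of roots, and each square
  -- is at least `(y - p)^2 / 4`.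
  nlinarith

lemma splitLik_le_exp {a b : ℕ} (ha : 0 < a) (hb : 0 < b) {y p : ℝ}
    (hp : p = a / ((a : ℝ) + b)) (hy0 : 0 ≤ y) (hy1 : y ≤ 1) :
    splitLik a b y ≤ splitLik a b p * Real.exp (-((a + b : ℝ) * (y - p) ^ 2 / 2)) := by
  have ha' : (0 : ℝ) < a := by exact_mod_cast ha
  have hb' : (0 : ℝ) < b := by exact_mod_cast hb
  have hp0 : 0 < p := by rw [hp]; positivity
  have hq : 1 - p = b / ((a : ℝ) + b) := by rw [hp]; field_simp; ring
  have hq0 : 0 < 1 - p := by rw [hq]; positivity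
  have h1 := pow_le_mul_exp_sqrt a hy0 hp0
  have h2 := pow_le_mul_exp_sqrt b (show 0 ≤ 1 - y by linarith) hq0
  have hA : (a : ℝ) * √(y / p) = (a + b) * (√p * √y) := by
    have hap : (a : ℝ) = (a + b) * (√p * √p) := by
      rw [Real.mul_self_sqrt hp0.le, hp]; field_simp
    rw [Real.sqrt_div' _ hp0.le]
    have : √p ≠ 0 := (Real.sqrt_pos.2 hp0).ne'
    field_simp
    linear_combination √y * hap
  have hB : (b : ℝ) * √((1 - y) / (1 - p)) = (a + b) * (√(1 - p) * √(1 - y)) := by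
    have hbp : (b : ℝ) = (a + b) * (√(1 - p) * √(1 - p)) := by
      rw [Real.mul_self_sqrt hq0.le, hq]; field_simp
    rw [Real.sqrt_div' _ hq0.le]
    have : √(1 - p) ≠ 0 := (Real.sqrt_pos.2 hq0).ne'
    field_simp
    linear_combination √(1 - y) * hbp
  unfold splitLik
  calc y ^ a * (1 - y) ^ b
      ≤ (p ^ a * Real.exp (2 * a * (√(y / p) - 1))) *
        ((1 - p) ^ b * Real.exp (2 * b * (√((1 - y) / (1 - p)) - 1))) :=
        mul_le_mul h1 h2 (pow_nonneg (by linarith) _) (by positivity)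
    _ = p ^ a * (1 - p) ^ b *
        Real.exp (2 * a * (√(y / p) - 1) + 2 * b * (√((1 - y) / (1 - p)) - 1)) := by
        rw [Real.exp_add]; ring
    _ ≤ _ := by
        have := sqrt_mul_add_sqrt_mul_le hp0.le (by linarith) hy0 hy1
        gcongr
        nlinarith

lemma splitLik_le_max {a b : ℕ} (ha : 0 < a) (hb : 0 < b) {y : ℝ} (hy0 : 0 ≤ y) (hy1 : y ≤ 1) :
    splitLik a b y ≤ splitLik a b (a / ((a : ℝ) + b)) := by
  refine (splitLik_le_exp ha hb rfl hy0 hy1).trans ?_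
  have h : splitLik a b (a / ((a : ℝ) + b)) ≥ 0 :=
    splitLik_nonneg _ _ (by positivity) (div_le_one_of_le₀ (by simp) (by positivity))
  refine mul_le_of_le_one_right h ?_
  rw [Real.exp_le_one_iff]
  have : 0 ≤ ((a : ℝ) + b) * (y - a / (a + b)) ^ 2 / 2 := by positivity
  linarith

/-- Bounding `2p` and `2(1-p)` by exponentials gives the exponent `(a-b)(2p-1)`, which is the
chi-square statistic of a fair split. It is the most that a slab can gain over the spike. -/
lemma splitLik_max_le {a b : ℕ} (ha : 0 < a) (hb : 0 < b) :
    splitLik a b (a / ((a : ℝ) + b)) ≤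
      splitLik a b (1 / 2) * Real.exp (((a : ℝ) - b) ^ 2 / (a + b)) := by
  have ha' : (0 : ℝ) < a := by exact_mod_cast ha
  have hb' : (0 : ℝ) < b := by exact_mod_cast hb
  set p : ℝ := a / ((a : ℝ) + b) with hp
  have hp0 : 0 < p := by rw [hp]; positivity
  have hq : 1 - p = b / ((a : ℝ) + b) := by rw [hp]; field_simp; ring
  have hq0 : 0 < 1 - p := by rw [hq]; positivity
  have h1 : p ≤ 1 / 2 * Real.exp (2 * p - 1) := by
    have := Real.add_one_le_exp (2 * p - 1); linarith
  have h2 : 1 - p ≤ 1 / 2 * Real.exp (1 - 2 * p) := by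
    have := Real.add_one_le_exp (1 - 2 * p); linarith
  calc splitLik a b p ≤ (1 / 2 * Real.exp (2 * p - 1)) ^ a * (1 / 2 * Real.exp (1 - 2 * p)) ^ b := by
        unfold splitLik; gcongr
    _ = splitLik a b (1 / 2) * Real.exp (a * (2 * p - 1) + b * (1 - 2 * p)) := by
        rw [splitLik_half, mul_pow, mul_pow, ← Real.exp_nat_mul, ← Real.exp_nat_mul, Real.exp_add,
          pow_add]; ring
    _ = _ := by
        congr 2
        rw [hp]; field_simp; ring

/-- Bernoulli's inequality: `(1 - h/p)^a ≥ 1 - a h/p = 1 - N h`. Used on both factors, it shows that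
the likelihood keeps a quarter of its maximum on an interval of length of order `1/N`. -/
lemma pow_ge_half {a : ℕ} {N p h y : ℝ} (hp : 0 < p) (hN : a = N * p) (hh : N * h ≤ 1 / 2)
    (hhp : h ≤ p) (hy : p - h ≤ y) : p ^ a / 2 ≤ y ^ a := by
  have h1 : 1 + (a : ℝ) * (-(h / p)) ≤ (1 + -(h / p)) ^ a :=
    one_add_mul_le_pow (by have : h / p ≤ 1 := (div_le_one hp).2 hhp
                           linarith) a
  have h2 : (a : ℝ) * (h / p) = N * h := by rw [hN]; field_simp
  calc p ^ a / 2 ≤ p ^ a * (1 + -(h / p)) ^ a := by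
        have : (1 : ℝ) / 2 ≤ (1 + -(h / p)) ^ a := by nlinarith
        have := mul_le_mul_of_nonneg_left this (pow_nonneg hp.le a)
        linarith
    _ = (p - h) ^ a := by rw [← mul_pow]; congr 1; field_simp; ring
    _ ≤ y ^ a := pow_le_pow_left₀ (by linarith) hy a

lemma splitLik_ge {a b : ℕ} (ha : 0 < a) (hb : 0 < b) {y p h : ℝ} (hp : p = a / ((a : ℝ) + b))
    (hh : (a + b : ℝ) * h ≤ 1 / 2) (h1 : h ≤ p) (h2 : h ≤ 1 - p)
    (hy : |y - p| ≤ h) : splitLik a b p / 4 ≤ splitLik a b y := by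
  have ha' : (0 : ℝ) < a := by exact_mod_cast ha
  have hb' : (0 : ℝ) < b := by exact_mod_cast hb
  have hp0 : 0 < p := by rw [hp]; positivity
  have hq : 1 - p = b / ((a : ℝ) + b) := by rw [hp]; field_simp; ring
  have hq0 : 0 < 1 - p := by rw [hq]; positivity
  obtain ⟨e1, e2⟩ := abs_le.1 hy
  have k1 := pow_ge_half (a := a) (N := a + b) (y := y) hp0 (by rw [hp]; field_simp) hh h1
    (by linarith)
  have k2 := pow_ge_half (a := b) (N := a + b) (y := 1 - y) hq0 (by rw [hq]; field_simp) hh h2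
    (by linarith)
  unfold splitLik
  calc p ^ a * (1 - p) ^ b / 4 = (p ^ a / 2) * ((1 - p) ^ b / 2) := by ring
    _ ≤ _ := mul_le_mul k1 k2 (by positivity) (le_trans (by positivity) k1)

/-! ### Posterior contraction at a single split -/

/-- With `1 ≤ s` both powers in the density are monotone in their bases, so each is smallest at base
`c`. -/
lemma exists_betaPDFReal_lower {s c : ℝ} (hs : 1 ≤ s) (hc : 0 < c) :
    ∃ K > 0, ∀ y, c ≤ y → y ≤ 1 - c → K ≤ betaPDFReal s s y := by
  have hB := beta_pos (show 0 < s by linarith) (show 0 < s by linarith)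
  refine ⟨1 / beta s s * c ^ (s - 1) * c ^ (s - 1), by positivity, fun y h1 h2 => ?_⟩
  rw [betaPDFReal, if_pos ⟨by linarith, by linarith⟩]
  have hy0 : 0 ≤ y := by linarith
  gcongr; linarith

lemma isProbabilityMeasure_spikeSlabLaw {w s : ℝ} (hw0 : 0 ≤ w) (hw1 : w ≤ 1) (hs : 0 < s) :
    IsProbabilityMeasure (spikeSlabLaw w s s) where
  measure_univ := by
    have := isProbabilityMeasureBeta hs hs
    simp only [spikeSlabLaw, Measure.coe_add, Measure.coe_smul, Pi.add_apply, Pi.smul_apply,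
      measure_univ, smul_eq_mul, mul_one]
    rw [← ENNReal.ofReal_add (by linarith) hw0]
    simp

lemma ae_betaMeasure_mem_Ioo (s t : ℝ) : ∀ᵐ y ∂betaMeasure s t, y ∈ Set.Ioo (0 : ℝ) 1 := by
  have hm : Measurable (betaPDF s t) := (measurable_betaPDFReal s t).ennreal_ofReal
  rw [betaMeasure, ae_withDensity_iff hm]
  refine ae_of_all _ fun y hy => ⟨?_, ?_⟩
  · by_contra h; exact hy (betaPDF_eq_zero_of_nonpos (not_lt.1 h))
  · by_contra h; exact hy (betaPDF_eq_zero_of_one_le (not_lt.1 h))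

lemma ae_spikeSlabLaw_mem_Ioo (w s t : ℝ) : ∀ᵐ y ∂spikeSlabLaw w s t, y ∈ Set.Ioo (0 : ℝ) 1 := by
  rw [spikeSlabLaw, ae_add_measure_iff]
  refine ⟨Measure.ae_smul_measure ?_ _, Measure.ae_smul_measure (ae_betaMeasure_mem_Ioo s t) _⟩
  refine (ae_dirac_iff (p := fun y : ℝ => y ∈ Set.Ioo (0 : ℝ) 1) measurableSet_Ioo).2 ?_
  norm_num

lemma lintegral_spikeSlabLaw (w s t : ℝ) {f : ℝ → ℝ≥0∞} (hf : Measurable f) :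
    ∫⁻ y, f y ∂spikeSlabLaw w s t =
      ENNReal.ofReal (1 - w) * f (1 / 2) + ENNReal.ofReal w * ∫⁻ y, f y ∂betaMeasure s t := by
  rw [spikeSlabLaw, lintegral_add_measure, lintegral_smul_measure, lintegral_smul_measure,
    lintegral_dirac' _ hf]
  rfl

/-- The spike dominates the posterior at a split whose data are nearly balanced. -/
lemma setLIntegral_spike_compl_le {a b : ℕ} (ha : 0 < a) (hb : 0 < b) {w s η : ℝ} (hs : 0 < s)
    (hw0 : 0 ≤ w) (hη : 0 ≤ η)
    (h : w * Real.exp (((a : ℝ) - b) ^ 2 / (a + b)) ≤ η * (1 - w)) :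
    ∫⁻ y in {1 / 2}ᶜ, ENNReal.ofReal (splitLik a b y) ∂spikeSlabLaw w s s ≤
      ENNReal.ofReal η * ∫⁻ y, ENNReal.ofReal (splitLik a b y) ∂spikeSlabLaw w s s := by
  have hpr := isProbabilityMeasureBeta hs hs
  have hm : Measurable fun y => ENNReal.ofReal (splitLik a b y) :=
    (measurable_splitLik a b).ennreal_ofReal
  have hms : MeasurableSet ({1 / 2}ᶜ : Set ℝ) := (measurableSet_singleton _).compl
  rw [← lintegral_indicator hms, lintegral_spikeSlabLaw _ _ _ (hm.indicator hms),
    lintegral_spikeSlabLaw _ _ _ hm]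
  -- The atom at `1/2` drops out on the left, leaving only the slab; on the right the atom alone
  -- will suffice.
  simp only [Set.mem_compl_iff, Set.mem_singleton_iff, not_true, not_false_eq_true,
    Set.indicator_of_notMem, mul_zero, zero_add]
  have hhalf : 0 ≤ splitLik a b (1 / 2) := splitLik_nonneg _ _ (by norm_num) (by norm_num)
  have h1 : ∫⁻ y, ({1 / 2}ᶜ : Set ℝ).indicator (fun y => ENNReal.ofReal (splitLik a b y)) y
      ∂betaMeasure s s ≤
      ENNReal.ofReal (splitLik a b (1 / 2) * Real.exp (((a : ℝ) - b) ^ 2 / (a + b))) := by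
    refine (lintegral_mono_ae (g := fun _ => ENNReal.ofReal (splitLik a b (1 / 2) *
      Real.exp (((a : ℝ) - b) ^ 2 / (a + b)))) ?_).trans (by simp)
    filter_upwards [ae_betaMeasure_mem_Ioo s s] with y hy
    refine (Set.indicator_le_self _ _ _).trans (ENNReal.ofReal_le_ofReal ?_)
    exact (splitLik_le_max ha hb hy.1.le hy.2.le).trans (splitLik_max_le ha hb)
  calc _ ≤ ENNReal.ofReal w * ENNReal.ofReal (splitLik a b (1 / 2) *
            Real.exp (((a : ℝ) - b) ^ 2 / (a + b))) := by gcongr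
    _ ≤ ENNReal.ofReal η * (ENNReal.ofReal (1 - w) * ENNReal.ofReal (splitLik a b (1 / 2))) := by
        rw [← ENNReal.ofReal_mul hw0, ← ENNReal.ofReal_mul' hhalf, ← ENNReal.ofReal_mul hη]
        apply ENNReal.ofReal_le_ofReal
        nlinarith
    _ ≤ _ := by gcongr; exact le_self_add

/-- The posterior at a split concentrates around the empirical proportion. -/
lemma setLIntegral_far_le {a b : ℕ} (ha : 0 < a) (hb : 0 < b) {w s η δ q p c h K : ℝ}
    (hs : 0 < s) (hw0 : 0 ≤ w) (hw1 : w ≤ 1) (hη : 0 ≤ η) (hδ : 0 ≤ δ)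
    (hp : p = a / ((a : ℝ) + b)) (hpq : |p - q| ≤ δ / 2) (hc1 : c ≤ p) (hc2 : c ≤ 1 - p)
    (hh0 : 0 ≤ h) (hhc : h ≤ c / 2) (hN : (a + b : ℝ) * h ≤ 1 / 2)
    (hK : ∀ y, c / 2 ≤ y → y ≤ 1 - c / 2 → K ≤ betaPDFReal s s y)
    (hexp : Real.exp (-((a + b : ℝ) * δ ^ 2 / 8)) ≤ η * w * K * h / 2) :
    ∫⁻ y in {y | |y - q| ≤ δ}ᶜ, ENNReal.ofReal (splitLik a b y) ∂spikeSlabLaw w s s ≤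
      ENNReal.ofReal η * ∫⁻ y, ENNReal.ofReal (splitLik a b y) ∂spikeSlabLaw w s s := by
  have hpr := isProbabilityMeasure_spikeSlabLaw hw0 hw1 hs
  have hm : Measurable fun y => ENNReal.ofReal (splitLik a b y) :=
    (measurable_splitLik a b).ennreal_ofReal
  have hms : MeasurableSet ({y : ℝ | |y - q| ≤ δ}ᶜ) :=
    (measurableSet_le (by fun_prop) measurable_const).compl
  have hp0 : 0 ≤ p := by rw [hp]; positivity
  have hp1 : p ≤ 1 := by linarith
  have hg : 0 ≤ splitLik a b p := splitLik_nonneg _ _ hp0 hp1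
  have up : ∫⁻ y in {y | |y - q| ≤ δ}ᶜ, ENNReal.ofReal (splitLik a b y) ∂spikeSlabLaw w s s ≤
      ENNReal.ofReal (splitLik a b p * Real.exp (-((a + b : ℝ) * δ ^ 2 / 8))) := by
    rw [← lintegral_indicator hms]
    refine (lintegral_mono_ae (g := fun _ => ENNReal.ofReal (splitLik a b p *
      Real.exp (-((a + b : ℝ) * δ ^ 2 / 8)))) ?_).trans (by simp)
    filter_upwards [ae_spikeSlabLaw_mem_Ioo w s s] with y hy
    by_cases hyA : y ∈ ({y : ℝ | |y - q| ≤ δ}ᶜ)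
    · rw [Set.indicator_of_mem hyA]
      apply ENNReal.ofReal_le_ofReal
      refine (splitLik_le_exp ha hb hp hy.1.le hy.2.le).trans ?_
      have hd : δ < |y - q| := by simpa using hyA
      -- Half of `δ` pays for the distance from `p` to `q`; the other half gives the exponent `(a+b)
      -- δ^2 / 8`.
      have hd2 : δ / 2 ≤ |y - p| := by
        have := abs_sub_le y p q; linarith
      have : (δ / 2) ^ 2 ≤ (y - p) ^ 2 := by
        rw [← sq_abs (y - p)]; gcongr
      refine mul_le_mul_of_nonneg_left (Real.exp_le_exp.2 ?_) hg
      have h2 : ((a : ℝ) + b) * (δ / 2) ^ 2 ≤ (a + b) * (y - p) ^ 2 := by gcongr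
      linarith
    · rw [Set.indicator_of_notMem hyA]; exact zero_le
  -- The normalizing integral is bounded below by the slab part over `[p - h, p + h]` alone.
  have low : ENNReal.ofReal (w * (splitLik a b p / 4 * K * (2 * h))) ≤
      ∫⁻ y, ENNReal.ofReal (splitLik a b y) ∂spikeSlabLaw w s s := by
    rw [lintegral_spikeSlabLaw _ _ _ hm]
    refine le_trans ?_ le_add_self
    rw [ENNReal.ofReal_mul hw0]
    gcongr
    rw [betaMeasure, lintegral_withDensity_eq_lintegral_mul _
      (show Measurable (betaPDF s s) from (measurable_betaPDFReal s s).ennreal_ofReal) hm]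
    refine le_trans ?_ (setLIntegral_le_lintegral (Set.Icc (p - h) (p + h)) _)
    have hvol : volume (Set.Icc (p - h) (p + h)) = ENNReal.ofReal (2 * h) := by
      rw [Real.volume_Icc]; ring_nf
    calc ENNReal.ofReal (splitLik a b p / 4 * K * (2 * h))
        = ∫⁻ y in Set.Icc (p - h) (p + h), ENNReal.ofReal (splitLik a b p / 4 * K) := by
          rw [setLIntegral_const, hvol, ENNReal.ofReal_mul' (by linarith)]
      _ ≤ _ := by
          refine setLIntegral_mono' measurableSet_Icc fun y hy => ?_
          have hy' : |y - p| ≤ h := abs_le.2 ⟨by linarith [hy.1], by linarith [hy.2]⟩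
          have k1 := splitLik_ge ha hb hp hN (by linarith) (by linarith) hy'
          have k2 := hK y (by linarith [hy.1]) (by linarith [hy.2])
          have k3 : 0 ≤ betaPDFReal s s y := by
            unfold betaPDFReal
            split_ifs with hy
            · have := beta_pos hs hs
              have h1 : 0 ≤ 1 - y := by linarith [hy.2]
              have := hy.1.le
              positivity
            · exact le_rfl
          simp only [Pi.mul_apply, betaPDF]
          rw [← ENNReal.ofReal_mul k3]
          apply ENNReal.ofReal_le_ofReal
          calc splitLik a b p / 4 * K ≤ splitLik a b p / 4 * betaPDFReal s s y := by gcongr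
            _ ≤ splitLik a b y * betaPDFReal s s y := by gcongr
            _ = _ := mul_comm _ _
  refine up.trans (le_trans ?_ (mul_le_mul_right low _))
  rw [← ENNReal.ofReal_mul hη]
  apply ENNReal.ofReal_le_ofReal
  calc _ ≤ splitLik a b p * (η * w * K * h / 2) := by gcongr
    _ = _ := by ring

/-! ### Dyadic intervals -/

lemma mem_dyadic {l k : ℕ} {x : ℝ} : x ∈ dyadic l k ↔ (k : ℝ) < 2 ^ l * x ∧ 2 ^ l * x ≤ k + 1 := by
  rw [dyadic, Set.mem_Ioc, div_lt_iff₀' (by positivity), le_div_iff₀' (by positivity)]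

lemma measurableSet_dyadic (l k : ℕ) : MeasurableSet (dyadic l k) := measurableSet_Ioc

lemma dyadic_unique {l k k' : ℕ} {x : ℝ} (h : x ∈ dyadic l k) (h' : x ∈ dyadic l k') : k = k' := by
  rw [mem_dyadic] at h h'
  have h1 : (k : ℝ) < k' + 1 := by linarith [h.1, h'.2]
  have h2 : (k' : ℝ) < k + 1 := by linarith [h'.1, h.2]
  norm_cast at h1 h2
  omega

lemma mem_dyadic_half {l k : ℕ} {x : ℝ} (h : x ∈ dyadic (l + 1) k) : x ∈ dyadic l (k / 2) := by
  rw [mem_dyadic, pow_succ] at h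
  rw [mem_dyadic]
  have h1 : 2 * (k / 2) ≤ k := by omega
  have h2 : k + 1 ≤ 2 * (k / 2) + 2 := by omega
  have h1' : (2 : ℝ) * (k / 2 : ℕ) ≤ k := by exact_mod_cast h1
  have h2' : (k : ℝ) + 1 ≤ 2 * (k / 2 : ℕ) + 2 := by exact_mod_cast h2
  constructor <;> linarith [h.1, h.2]

lemma dyadic_succ (l k : ℕ) :
    dyadic l k = dyadic (l + 1) (2 * k) ∪ dyadic (l + 1) (2 * k + 1) := by
  ext x
  simp only [Set.mem_union, mem_dyadic, pow_succ]
  push_cast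
  constructor
  · rintro ⟨h1, h2⟩
    rcases le_or_gt (2 ^ l * 2 * x) (2 * k + 1) with h | h
    · left; constructor <;> linarith
    · right; constructor <;> linarith
  · rintro (⟨h1, h2⟩ | ⟨h1, h2⟩) <;> constructor <;> linarith

lemma disjoint_dyadic {l k k' : ℕ} (h : k ≠ k') : Disjoint (dyadic l k) (dyadic l k') :=
  Set.disjoint_left.2 fun _ h1 h2 => h (dyadic_unique h1 h2)

lemma exists_mem_dyadic (l : ℕ) {x : ℝ} (hx : x ∈ Set.Ioc (0 : ℝ) 1) :
    ∃ k < 2 ^ l, x ∈ dyadic l k := by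
  have hpos : 0 < 2 ^ l * x := mul_pos (by positivity) hx.1
  have hc : 0 < ⌈2 ^ l * x⌉₊ := Nat.ceil_pos.2 hpos
  obtain ⟨m, hm⟩ := Nat.exists_eq_add_of_lt hc
  rw [zero_add] at hm
  refine ⟨m, ?_, ?_⟩
  · have : ⌈2 ^ l * x⌉₊ ≤ 2 ^ l := by
      apply Nat.ceil_le.2
      push_cast
      exact mul_le_of_le_one_right (by positivity) hx.2
    omega
  · rw [mem_dyadic]
    have h1 := Nat.ceil_lt_add_one hpos.le
    have h2 := Nat.le_ceil (2 ^ l * x)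
    rw [hm] at h1 h2
    push_cast at h1 h2
    exact ⟨by linarith, h2⟩

lemma dyadic_subset {l k : ℕ} (hk : k < 2 ^ l) : dyadic l k ⊆ Set.Ioc (0 : ℝ) 1 := by
  intro x hx
  rw [mem_dyadic] at hx
  have hp : (0 : ℝ) < 2 ^ l := by positivity
  have hk' : (k : ℝ) + 1 ≤ 2 ^ l := by exact_mod_cast hk
  refine ⟨?_, ?_⟩
  · have : 0 < 2 ^ l * x := lt_of_le_of_lt (Nat.cast_nonneg k) hx.1
    exact pos_of_mul_pos_right this hp.le
  · by_contra h
    nlinarith [hx.2]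

/-! ### The likelihood factorizes over the splits -/

/-- The number of sample points in the dyadic interval `(l, k)`. -/
def count {n : ℕ} (x : Fin n → ℝ) (l k : ℕ) : ℕ :=
  ∑ i, (dyadic l k).indicator (fun _ => 1) (x i)

lemma count_succ {n : ℕ} (x : Fin n → ℝ) (l k : ℕ) :
    count x l k = count x (l + 1) (2 * k) + count x (l + 1) (2 * k + 1) := by
  unfold count
  rw [← Finset.sum_add_distrib]
  refine Finset.sum_congr rfl fun i _ => ?_
  rw [dyadic_succ, Set.indicator_union_of_disjoint (disjoint_dyadic (by omega))]

lemma count_le {n : ℕ} (x : Fin n → ℝ) (l k : ℕ) : count x l k ≤ n := by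
  calc count x l k ≤ ∑ _i : Fin n, 1 :=
        Finset.sum_le_sum fun i _ => Set.indicator_apply_le' (fun _ => le_rfl) (fun _ => zero_le_one)
    _ = n := by simp

/-- Nodes whose interval misses `x` have exponent zero, so the product along a branch becomes a
product over all nodes. The index set no longer depends on `x`, and the product over the sample can
be interchanged with it. -/
lemma treeMass_eq_prod {L : ℕ} (y : Node L → ℝ) {x : ℝ} (l : ℕ) :
    ∀ k < 2 ^ l, x ∈ dyadic l k →
    treeMass y l k = ∏ j ∈ Finset.range l, ∏ m ∈ Finset.range (2 ^ j),
      (splitVar y j m ^ (dyadic (j + 1) (2 * m)).indicator (fun _ => 1) x *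
        (1 - splitVar y j m) ^ (dyadic (j + 1) (2 * m + 1)).indicator (fun _ => 1) x) := by
  induction l with
  | zero => intro k _ _; simp [treeMass]
  | succ l ih =>
    intro k hk hx
    have hk2 : k / 2 < 2 ^ l := by rw [pow_succ] at hk; omega
    rw [Finset.prod_range_succ, ← ih (k / 2) hk2 (mem_dyadic_half hx),
      Finset.prod_eq_single_of_mem (k / 2) (Finset.mem_range.2 hk2), treeMass]
    · congr 1
      rcases Nat.mod_two_eq_zero_or_one k with h | h
      · have e : 2 * (k / 2) = k := by omega
        have hn : x ∉ dyadic (l + 1) (k + 1) := fun h' => by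
          have := dyadic_unique hx h'; omega
        rw [e, if_pos h, Set.indicator_of_mem hx, Set.indicator_of_notMem hn]
        simp
      · have e : 2 * (k / 2) + 1 = k := by omega
        have hn : x ∉ dyadic (l + 1) (2 * (k / 2)) := fun h' => by
          have := dyadic_unique hx h'; omega
        rw [e, if_neg (by omega), Set.indicator_of_mem hx, Set.indicator_of_notMem hn]
        simp
    · intro m _ hm
      rw [Set.indicator_of_notMem (fun h => hm (by have := dyadic_unique hx h; omega)),
        Set.indicator_of_notMem (fun h => hm (by have := dyadic_unique hx h; omega))]
      simp

lemma treeDensity_eq {L : ℕ} (y : Node L → ℝ) {x : ℝ} {k : ℕ} (hk : k < 2 ^ L)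
    (hx : x ∈ dyadic L k) : treeDensity y x = 2 ^ L * treeMass y L k := by
  unfold treeDensity
  rw [Finset.sum_eq_single_of_mem k (Finset.mem_range.2 hk), Set.indicator_of_mem hx]
  intro m _ hm
  exact Set.indicator_of_notMem (fun h => hm (dyadic_unique h hx)) _

lemma prod_range_eq_prod_node {L : ℕ} (F : ℕ → ℕ → ℝ) :
    ∏ j ∈ Finset.range L, ∏ m ∈ Finset.range (2 ^ j), F j m = ∏ e : Node L, F e.1 e.2 := by
  rw [← Finset.univ_sigma_univ, Finset.prod_sigma, ← Fin.prod_univ_eq_prod_range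
    (fun j => ∏ m ∈ Finset.range (2 ^ j), F j m)]
  exact Finset.prod_congr rfl fun j _ => (Fin.prod_univ_eq_prod_range (fun m => F j m) _).symm

lemma splitVar_node {L : ℕ} (y : Node L → ℝ) (e : Node L) : splitVar y e.1 e.2 = y e := by
  unfold splitVar
  rw [dif_pos ⟨e.1.2, e.2.2⟩]

lemma treeDensity_eq_prod {L : ℕ} (y : Node L → ℝ) {x : ℝ} (hx : x ∈ Set.Ioc (0 : ℝ) 1) :
    treeDensity y x = 2 ^ L * ∏ e : Node L,
      (y e ^ (dyadic (e.1 + 1) (2 * e.2)).indicator (fun _ => 1) x *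
        (1 - y e) ^ (dyadic (e.1 + 1) (2 * e.2 + 1)).indicator (fun _ => 1) x) := by
  obtain ⟨k, hk, hxk⟩ := exists_mem_dyadic L hx
  rw [treeDensity_eq y hk hxk, treeMass_eq_prod y L k hk hxk, prod_range_eq_prod_node (fun j m =>
    (splitVar y j m ^ (dyadic (j + 1) (2 * m)).indicator (fun _ => 1) x *
        (1 - splitVar y j m) ^ (dyadic (j + 1) (2 * m + 1)).indicator (fun _ => 1) x))]
  simp only [splitVar_node]

lemma likelihood_eq_prod {L n : ℕ} {x : Fin n → ℝ} (hx : ∀ i, x i ∈ Set.Ioc (0 : ℝ) 1)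
    {y : Node L → ℝ} (hy : ∀ e, y e ∈ Set.Ioo (0 : ℝ) 1) :
    likelihood x y = ENNReal.ofReal ((2 ^ L) ^ n) * ∏ e : Node L, ENNReal.ofReal
      (splitLik (count x (e.1 + 1) (2 * e.2)) (count x (e.1 + 1) (2 * e.2 + 1)) (y e)) := by
  have h0 : ∀ e, 0 ≤ y e := fun e => (hy e).1.le
  have h1 : ∀ e, 0 ≤ 1 - y e := fun e => by linarith [(hy e).2]
  have hs : ∀ e ∈ Finset.univ, 0 ≤ splitLik (count x (e.1 + 1) (2 * e.2))
      (count x (e.1 + 1) (2 * e.2 + 1)) (y e) :=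
    fun e _ => splitLik_nonneg _ _ (hy e).1.le (hy e).2.le
  rw [← ENNReal.ofReal_prod_of_nonneg hs, ← ENNReal.ofReal_mul (by positivity), likelihood,
    ← ENNReal.ofReal_prod_of_nonneg]
  · congr 1
    simp_rw [treeDensity_eq_prod y (hx _)]
    rw [Finset.prod_mul_distrib, Finset.prod_comm]
    congr 1
    · simp
    · refine Finset.prod_congr rfl fun e _ => ?_
      rw [Finset.prod_mul_distrib, Finset.prod_pow_eq_pow_sum, Finset.prod_pow_eq_pow_sum]
      rfl
  · intro i _
    rw [treeDensity_eq_prod y (hx i)]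
    exact mul_nonneg (by positivity) (Finset.prod_nonneg fun e _ =>
      mul_nonneg (pow_nonneg (h0 e) _) (pow_nonneg (h1 e) _))

/-! ### The posterior is a product measure -/

lemma lintegral_pi_prod {ι : Type*} [Fintype ι] (ν : ι → Measure ℝ)
    [∀ e, IsProbabilityMeasure (ν e)] {g : ι → ℝ → ℝ≥0∞} (hg : ∀ e, Measurable (g e)) :
    ∫⁻ y, ∏ e, g e (y e) ∂Measure.pi ν = ∏ e, ∫⁻ t, g e t ∂ν e := by
  have hi : iIndepFun (fun e (y : ι → ℝ) => g e (y e)) (Measure.pi ν) :=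
    iIndepFun_pi fun e => (hg e).aemeasurable
  have := lintegral_prod_eq_prod_lintegral_of_indepFun Finset.univ
    (fun e (y : ι → ℝ) => g e (y e)) hi (fun e => (hg e).comp (measurable_pi_apply e))
  refine this.trans (Finset.prod_congr rfl fun e _ => ?_)
  exact (measurePreserving_eval ν e).lintegral_comp (hg e)

/-- Restricting one coordinate alters one factor of the product of integrals, so a one-dimensional
bound carries over with the same constant. -/
lemma setLIntegral_pi_prod_le {ι : Type*} [Fintype ι] (ν : ι → Measure ℝ)
    [∀ e, IsProbabilityMeasure (ν e)] {g : ι → ℝ → ℝ≥0∞} (hg : ∀ e, Measurable (g e))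
    {B : Set ℝ} (hB : MeasurableSet B) (e : ι) {η : ℝ≥0∞}
    (h : ∫⁻ t in B, g e t ∂ν e ≤ η * ∫⁻ t, g e t ∂ν e) :
    ∫⁻ y in {y | y e ∈ B}, ∏ e', g e' (y e') ∂Measure.pi ν ≤
      η * ∫⁻ y, ∏ e', g e' (y e') ∂Measure.pi ν := by
  classical
  have hBm : MeasurableSet {y : ι → ℝ | y e ∈ B} := measurable_pi_apply e hB
  set g' : ι → ℝ → ℝ≥0∞ := Function.update g e (B.indicator (g e)) with hg'
  have hgm : ∀ e', Measurable (g' e') := by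
    intro e'
    by_cases he : e' = e
    · subst he; rw [hg', Function.update_self]; exact (hg e').indicator hB
    · rw [hg', Function.update_of_ne he]; exact hg e'
  have hcongr : ∀ y, {y : ι → ℝ | y e ∈ B}.indicator (fun y => ∏ e', g e' (y e')) y =
      ∏ e', g' e' (y e') := by
    intro y
    rw [← Finset.mul_prod_erase _ _ (Finset.mem_univ e)]
    have : ∏ e' ∈ Finset.univ.erase e, g' e' (y e') = ∏ e' ∈ Finset.univ.erase e, g e' (y e') :=
      Finset.prod_congr rfl fun e' he => by
        rw [hg', Function.update_of_ne (Finset.ne_of_mem_erase he)]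
    rw [this, hg', Function.update_self]
    by_cases hy : y e ∈ B
    · rw [Set.indicator_of_mem (show y ∈ {y : ι → ℝ | y e ∈ B} from hy), Set.indicator_of_mem hy,
        Finset.mul_prod_erase _ (fun e' => g e' (y e')) (Finset.mem_univ e)]
    · rw [Set.indicator_of_notMem (show y ∉ {y : ι → ℝ | y e ∈ B} from hy),
        Set.indicator_of_notMem hy, zero_mul]
  rw [← lintegral_indicator hBm]
  simp_rw [hcongr]
  rw [lintegral_pi_prod ν hgm, lintegral_pi_prod ν hg,
    ← Finset.mul_prod_erase _ _ (Finset.mem_univ e),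
    ← Finset.mul_prod_erase _ (fun e' => ∫⁻ t, g e' t ∂ν e') (Finset.mem_univ e), ← mul_assoc]
  have : ∏ e' ∈ Finset.univ.erase e, ∫⁻ t, g' e' t ∂ν e' =
      ∏ e' ∈ Finset.univ.erase e, ∫⁻ t, g e' t ∂ν e' :=
    Finset.prod_congr rfl fun e' he => by
      rw [hg', Function.update_of_ne (Finset.ne_of_mem_erase he)]
  rw [this]
  gcongr
  rw [hg', Function.update_self, lintegral_indicator hB]
  exact h

lemma lintegral_splitLik_ne_zero {ν : Measure ℝ} [IsProbabilityMeasure ν]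
    (hν : ∀ᵐ y ∂ν, y ∈ Set.Ioo (0 : ℝ) 1) (a b : ℕ) :
    ∫⁻ y, ENNReal.ofReal (splitLik a b y) ∂ν ≠ 0 := by
  intro h
  rw [lintegral_eq_zero_iff (measurable_splitLik a b).ennreal_ofReal] at h
  have : ∀ᵐ y ∂ν, False := by
    filter_upwards [h, hν] with y h1 h2
    have : 0 < splitLik a b y :=
      mul_pos (pow_pos h2.1 _) (pow_pos (by linarith [h2.2]) _)
    simp only [Pi.zero_apply, ENNReal.ofReal_eq_zero] at h1
    linarith
  exact IsProbabilityMeasure.ne_zero ν (by simpa using this)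

lemma lintegral_splitLik_ne_top {ν : Measure ℝ} [IsProbabilityMeasure ν]
    (hν : ∀ᵐ y ∂ν, y ∈ Set.Ioo (0 : ℝ) 1) (a b : ℕ) :
    ∫⁻ y, ENNReal.ofReal (splitLik a b y) ∂ν ≠ ∞ := by
  have : ∫⁻ y, ENNReal.ofReal (splitLik a b y) ∂ν ≤ ∫⁻ _, 1 ∂ν := by
    refine lintegral_mono_ae ?_
    filter_upwards [hν] with y hy
    rw [← ENNReal.ofReal_one]
    apply ENNReal.ofReal_le_ofReal
    exact mul_le_one₀ (pow_le_one₀ hy.1.le hy.2.le) (pow_nonneg (by linarith [hy.2]) _)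
      (pow_le_one₀ (by linarith [hy.2]) (by linarith [hy.1]))
  exact ne_top_of_le_ne_top (by simp) this

/-- If at each split the posterior charges `(A e)ᶜ` with mass at most `η`, then the posterior of
the whole tree charges the rectangle `∏ A e` with mass at least `1 - η · card`. -/
lemma one_sub_le_bayesPosterior_real {L n : ℕ} (ν : Node L → Measure ℝ)
    [∀ e, IsProbabilityMeasure (ν e)] (hν : ∀ e, ∀ᵐ y ∂ν e, y ∈ Set.Ioo (0 : ℝ) 1)
    {x : Fin n → ℝ} (hx : ∀ i, x i ∈ Set.Ioc (0 : ℝ) 1) {A : Node L → Set ℝ}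
    (hA : ∀ e, MeasurableSet (A e)) {η : ℝ} (hη : 0 ≤ η)
    (h : ∀ e : Node L, ∫⁻ y in (A e)ᶜ, ENNReal.ofReal (splitLik (count x (e.1 + 1) (2 * e.2))
        (count x (e.1 + 1) (2 * e.2 + 1)) y) ∂ν e ≤
      ENNReal.ofReal η * ∫⁻ y, ENNReal.ofReal (splitLik (count x (e.1 + 1) (2 * e.2))
        (count x (e.1 + 1) (2 * e.2 + 1)) y) ∂ν e)
    {S : Set (Node L → ℝ)} (hS : ∀ y, (∀ e, y e ∈ A e) → y ∈ S) :
    1 - Fintype.card (Node L) * η ≤ (bayesPosterior (Measure.pi ν) x).real S ∧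
      (bayesPosterior (Measure.pi ν) x).real S ≤ 1 := by
  set g : Node L → ℝ → ℝ≥0∞ := fun e y => ENNReal.ofReal (splitLik (count x (e.1 + 1) (2 * e.2))
        (count x (e.1 + 1) (2 * e.2 + 1)) y) with hgdef
  have hg : ∀ e, Measurable (g e) := fun e => (measurable_splitLik _ _).ennreal_ofReal
  set c : ℝ≥0∞ := ENNReal.ofReal ((2 ^ L) ^ n) with hc
  have hc0 : c ≠ 0 := by rw [hc]; simp
  have hct : c ≠ ∞ := ENNReal.ofReal_ne_top
  have hmeas : Measurable fun y : Node L → ℝ => ∏ e, g e (y e) :=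
    Finset.measurable_prod _ fun e _ => (hg e).comp (measurable_pi_apply e)
  have hlik : likelihood x =ᵐ[Measure.pi ν] fun y => c * ∏ e, g e (y e) := by
    have : ∀ᵐ y ∂Measure.pi ν, ∀ e, y e ∈ Set.Ioo (0 : ℝ) 1 :=
      ae_all_iff.2 fun e => (Measure.quasiMeasurePreserving_eval ν e).ae (hν e)
    filter_upwards [this] with y hy
    exact likelihood_eq_prod hx hy
  set Z := ∫⁻ y, likelihood x y ∂Measure.pi ν with hZ
  have hZ' : Z = c * ∫⁻ y, ∏ e, g e (y e) ∂Measure.pi ν := by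
    rw [hZ, lintegral_congr_ae hlik, lintegral_const_mul _ hmeas]
  have hI := lintegral_pi_prod ν hg
  have hZ0 : Z ≠ 0 := by
    rw [hZ', hI]
    exact mul_ne_zero hc0 (Finset.prod_ne_zero_iff.2 fun e _ =>
      lintegral_splitLik_ne_zero (hν e) _ _)
  have hZt : Z ≠ ∞ := by
    rw [hZ', hI]
    exact ENNReal.mul_ne_top hct (ENNReal.prod_ne_top fun e _ =>
      lintegral_splitLik_ne_top (hν e) _ _)
  have hpr : IsProbabilityMeasure (bayesPosterior (Measure.pi ν) x) := by
    constructor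
    rw [bayesPosterior, Measure.smul_apply, withDensity_apply _ MeasurableSet.univ,
      Measure.restrict_univ, smul_eq_mul]
    exact ENNReal.inv_mul_cancel hZ0 hZt
  refine ⟨?_, measureReal_le_one⟩
  have hbad : ∀ e, bayesPosterior (Measure.pi ν) x {y | y e ∈ (A e)ᶜ} ≤ ENNReal.ofReal η := by
    intro e
    have hm : MeasurableSet {y : Node L → ℝ | y e ∈ (A e)ᶜ} := measurable_pi_apply e (hA e).compl
    rw [bayesPosterior, Measure.smul_apply, withDensity_apply _ hm, smul_eq_mul]
    have h1 : ∫⁻ y in {y | y e ∈ (A e)ᶜ}, likelihood x y ∂Measure.pi ν ≤ ENNReal.ofReal η * Z := by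
      rw [lintegral_congr_ae (ae_restrict_of_ae hlik), lintegral_const_mul _ hmeas, hZ',
        mul_left_comm]
      gcongr
      exact setLIntegral_pi_prod_le ν hg (hA e).compl e (h e)
    calc Z⁻¹ * _ ≤ Z⁻¹ * (ENNReal.ofReal η * Z) := by gcongr
      _ = ENNReal.ofReal η := by
        rw [mul_left_comm, ENNReal.inv_mul_cancel hZ0 hZt, mul_one]
  have hAm : MeasurableSet {y : Node L → ℝ | ∀ e, y e ∈ A e} := by
    rw [Set.ofPred_forall]
    exact MeasurableSet.iInter fun e => measurable_pi_apply e (hA e)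
  have hcompl : (bayesPosterior (Measure.pi ν) x).real {y | ∀ e, y e ∈ A e}ᶜ ≤
      Fintype.card (Node L) * η := by
    have : {y : Node L → ℝ | ∀ e, y e ∈ A e}ᶜ = ⋃ e, {y | y e ∈ (A e)ᶜ} := by
      ext y; simp
    rw [this]
    calc _ ≤ ∑ e, (bayesPosterior (Measure.pi ν) x).real {y | y e ∈ (A e)ᶜ} :=
          measureReal_iUnion_fintype_le _
      _ ≤ ∑ _e : Node L, η := Finset.sum_le_sum fun e _ => by
          rw [measureReal_def]
          exact ENNReal.toReal_le_of_le_ofReal hη (hbad e)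
      _ = _ := by simp
  have h2 := probReal_compl_eq_one_sub (μ := bayesPosterior (Measure.pi ν) x) hAm
  -- Only monotonicity is used for `S`, so `S` need not be measurable.
  have h3 : (bayesPosterior (Measure.pi ν) x).real {y | ∀ e, y e ∈ A e} ≤
      (bayesPosterior (Measure.pi ν) x).real S := measureReal_mono hS
  linarith

lemma card_node_le {L n : ℕ} (h : 2 ^ L ≤ n) : Fintype.card (Node L) ≤ n := by
  rw [Fintype.card_sigma]
  simp only [Fintype.card_fin]
  rw [Fin.sum_univ_eq_sum_range (fun l => 2 ^ l)]
  have := Nat.geomSum_lt (m := 2) (n := L) (s := Finset.range L) le_rfl (by simp)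
  omega

/-! ### Dyadic masses and Haar coefficients -/

/-- The mass of the dyadic interval `(l, k)` under the density `f`. -/
def mass (f : ℝ → ℝ) (l k : ℕ) : ℝ := ∫ x in dyadic l k, f x ∂lebUnit

lemma lebUnit_real_dyadic {l k : ℕ} (hk : k < 2 ^ l) :
    lebUnit.real (dyadic l k) = 1 / 2 ^ l := by
  rw [lebUnit, measureReal_restrict_apply (measurableSet_dyadic l k),
    Set.inter_eq_left.2 ((dyadic_subset hk).trans Set.Ioc_subset_Icc_self), dyadic,
    Real.volume_real_Ioc_of_le (by gcongr; linarith)]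
  field_simp
  ring

instance : IsFiniteMeasure lebUnit := by unfold lebUnit; infer_instance

lemma mass_bounds {f : ℝ → ℝ} {m₀ m₁ : ℝ} (hf : f ∈ BoundedDensities m₀ m₁) {l k : ℕ}
    (hk : k < 2 ^ l) : m₀ / 2 ^ l ≤ mass f l k ∧ mass f l k ≤ m₁ / 2 ^ l := by
  have hc : ∀ m : ℝ, ∫ _ in dyadic l k, m ∂lebUnit = m / 2 ^ l := fun m => by
    rw [setIntegral_const, lebUnit_real_dyadic hk, smul_eq_mul]; ring
  obtain ⟨hi, -, hb⟩ := hf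
  rw [← hc, ← hc]
  constructor
  · exact integral_mono_ae (integrable_const _) hi.integrableOn
      (ae_restrict_of_ae (hb.mono fun x hx => hx.1))
  · exact integral_mono_ae hi.integrableOn (integrable_const _)
      (ae_restrict_of_ae (hb.mono fun x hx => hx.2))

lemma mass_succ {f : ℝ → ℝ} (hf : Integrable f lebUnit) (l k : ℕ) :
    mass f l k = mass f (l + 1) (2 * k) + mass f (l + 1) (2 * k + 1) := by
  unfold mass
  rw [dyadic_succ, setIntegral_union (disjoint_dyadic (by omega)) (measurableSet_dyadic _ _)
    hf.integrableOn hf.integrableOn]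

lemma mass_zero {f : ℝ → ℝ} (h1 : ∫ x, f x ∂lebUnit = 1) : mass f 0 0 = 1 := by
  rw [← h1, mass, lebUnit, Measure.restrict_restrict (measurableSet_dyadic _ _)]
  have : dyadic 0 0 = Set.Ioc 0 1 := by simp [dyadic]
  rw [this, Set.inter_eq_left.2 Set.Ioc_subset_Icc_self, integral_Icc_eq_integral_Ioc]

lemma haar_eq (l k : ℕ) (x : ℝ) : haar l k x = (2 : ℝ) ^ ((l : ℝ) / 2) *
    ((dyadic (l + 1) (2 * k + 1)).indicator 1 x - (dyadic (l + 1) (2 * k)).indicator 1 x) := by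
  have h1 : 2 ^ l * x - k ∈ Set.Ioc (0 : ℝ) (1 / 2) ↔ x ∈ dyadic (l + 1) (2 * k) := by
    rw [mem_dyadic, Set.mem_Ioc, pow_succ]
    push_cast
    constructor <;> rintro ⟨h, h'⟩ <;> constructor <;> linarith
  have h2 : 2 ^ l * x - k ∈ Set.Ioc (1 / 2 : ℝ) 1 ↔ x ∈ dyadic (l + 1) (2 * k + 1) := by
    rw [mem_dyadic, Set.mem_Ioc, pow_succ]
    push_cast
    constructor <;> rintro ⟨h, h'⟩ <;> constructor <;> linarith
  classical
  simp only [haar, haarMother, Set.indicator_apply, h1, h2, Pi.one_apply]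
  ring

lemma haarCoeff_eq {f : ℝ → ℝ} (hf : Integrable f lebUnit) (l k : ℕ) :
    haarCoeff f l k =
      (2 : ℝ) ^ ((l : ℝ) / 2) * (mass f (l + 1) (2 * k + 1) - mass f (l + 1) (2 * k)) := by
  unfold mass
  rw [← integral_indicator (measurableSet_dyadic _ _), ← integral_indicator
    (measurableSet_dyadic _ _), ← integral_sub (hf.indicator (measurableSet_dyadic _ _))
    (hf.indicator (measurableSet_dyadic _ _)), ← integral_const_mul, haarCoeff]
  congr 1 with x
  classical
  rw [haar_eq]
  simp only [Set.indicator_apply, Pi.one_apply]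
  split_ifs <;> ring

lemma abs_mass_sub_le {f : ℝ → ℝ} {α R : ℝ} (hH : f ∈ HolderBall α R)
    (hf : Integrable f lebUnit) {l k : ℕ} (hk : k < 2 ^ l) :
    |mass f (l + 1) (2 * k + 1) - mass f (l + 1) (2 * k)| ≤ R * ((2 : ℝ) ^ (-α)) ^ l / 2 ^ l := by
  have h := hH l k hk
  have hp : (0 : ℝ) < 2 ^ ((l : ℝ) / 2) := by positivity
  rw [haarCoeff_eq hf, abs_mul, abs_of_pos hp, ← le_div_iff₀' hp] at h
  refine h.trans_eq ?_
  rw [mul_div_assoc, mul_div_assoc, ← Real.rpow_natCast, ← Real.rpow_natCast,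
    ← Real.rpow_mul (by norm_num), ← Real.rpow_sub (by norm_num), ← Real.rpow_sub (by norm_num)]
  ring_nf

lemma abs_average_succ_sub_le {f : ℝ → ℝ} {α R : ℝ} (hH : f ∈ HolderBall α R)
    (hf : Integrable f lebUnit) {l k : ℕ} (hk : k < 2 ^ (l + 1)) :
    |2 ^ (l + 1) * mass f (l + 1) k - 2 ^ l * mass f l (k / 2)| ≤ R * ((2 : ℝ) ^ (-α)) ^ l := by
  have hk2 : k / 2 < 2 ^ l := by rw [pow_succ] at hk; omega
  have h := abs_mass_sub_le hH hf hk2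
  rw [le_div_iff₀' (by positivity)] at h
  have hs := mass_succ hf l (k / 2)
  have h2 : (0 : ℝ) < 2 ^ l := by positivity
  rw [← abs_of_pos h2, ← abs_mul] at h
  rcases Nat.mod_two_eq_zero_or_one k with hm | hm
  · have e : 2 * (k / 2) = k := by omega
    rw [e] at h hs
    rw [hs, show 2 ^ (l + 1) * mass f (l + 1) k - 2 ^ l *
      (mass f (l + 1) k + mass f (l + 1) (k + 1)) =
      -(2 ^ l * (mass f (l + 1) (k + 1) - mass f (l + 1) k)) by ring, abs_neg]
    exact h
  · have e : 2 * (k / 2) + 1 = k := by omega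
    rw [e] at h hs
    rw [hs, show 2 ^ (l + 1) * mass f (l + 1) k - 2 ^ l *
      (mass f (l + 1) (2 * (k / 2)) + mass f (l + 1) k) =
      2 ^ l * (mass f (l + 1) k - mass f (l + 1) (2 * (k / 2))) by ring]
    exact h

lemma rpow_neg_mem {α : ℝ} (hα : 0 < α) : 0 < (2 : ℝ) ^ (-α) ∧ (2 : ℝ) ^ (-α) < 1 :=
  ⟨by positivity, Real.rpow_lt_one_of_one_lt_of_neg (by norm_num) (by linarith)⟩

lemma abs_average_sub_le {f : ℝ → ℝ} {α R : ℝ} (hα : 0 < α) (hR : 0 ≤ R) (hH : f ∈ HolderBall α R)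
    (hf : Integrable f lebUnit) {x : ℝ} {k : ℕ → ℕ} (hk : ∀ l, k l < 2 ^ l)
    (hx : ∀ l, x ∈ dyadic l (k l)) (J i : ℕ) :
    |2 ^ (J + i) * mass f (J + i) (k (J + i)) - 2 ^ J * mass f J (k J)| ≤
      R * ((2 : ℝ) ^ (-α)) ^ J / (1 - (2 : ℝ) ^ (-α)) := by
  obtain ⟨h0, h1⟩ := rpow_neg_mem hα
  set ρ := (2 : ℝ) ^ (-α) with hρ
  have h1' : 0 < 1 - ρ := by linarith
  -- The increments telescope; the factor `1 - ρ^i` of the partial geometric sum is what makes the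
  -- induction close.
  have key : |2 ^ (J + i) * mass f (J + i) (k (J + i)) - 2 ^ J * mass f J (k J)| ≤
      R * ρ ^ J * (1 - ρ ^ i) / (1 - ρ) := by
    induction i with
    | zero => simp
    | succ i ih =>
      have h := abs_average_succ_sub_le hH hf (hk (J + i + 1))
      have e : k (J + i + 1) / 2 = k (J + i) := dyadic_unique (mem_dyadic_half (hx _)) (hx _)
      rw [e, ← hρ] at h
      have := abs_sub_le (2 ^ (J + i + 1) * mass f (J + i + 1) (k (J + i + 1)))
        (2 ^ (J + i) * mass f (J + i) (k (J + i))) (2 ^ J * mass f J (k J))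
      refine this.trans ((add_le_add h ih).trans_eq ?_)
      rw [pow_add, pow_succ]
      field_simp
      ring
  have hi : 1 - ρ ^ i ≤ 1 := by have : 0 < ρ ^ i := pow_pos h0 i; linarith
  refine key.trans (div_le_div_of_nonneg_right ?_ h1'.le)
  exact mul_le_of_le_one_right (by positivity) hi

lemma mass_eq_integral_indicator {f : ℝ → ℝ} (l k : ℕ) :
    mass f l k = ∫ x in dyadic l k, (Set.Icc (0 : ℝ) 1).indicator f x := by
  rw [mass, lebUnit, Measure.restrict_restrict (measurableSet_dyadic _ _),
    setIntegral_indicator measurableSet_Icc]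

/-- The dyadic averages converge almost everywhere. -/
lemma ae_tendsto_dyadic_average {f : ℝ → ℝ} (hf : Integrable f lebUnit) :
    ∀ᵐ x ∂lebUnit, ∀ k : ℕ → ℕ, (∀ l, x ∈ dyadic l (k l)) →
      Tendsto (fun l => 2 ^ l * mass f l (k l)) atTop (𝓝 (f x)) := by
  have hg : Integrable ((Set.Icc (0 : ℝ) 1).indicator f) volume :=
    (integrable_indicator_iff measurableSet_Icc).2 hf
  -- Lebesgue differentiation along balls that contain `x` without being centred at it; the closure
  -- of a dyadic interval is such a ball.
  have hae := IsUnifLocDoublingMeasure.ae_tendsto_average volume hg.locallyIntegrable 1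
  rw [lebUnit, ae_restrict_iff' measurableSet_Icc]
  filter_upwards [hae] with x hx hx01 k hk
  have hball : ∀ l, Metric.closedBall (((k l : ℝ) + 1 / 2) / 2 ^ l) (1 / 2 * (1 / 2) ^ l) =
      Set.Icc ((k l : ℝ) / 2 ^ l) (((k l : ℝ) + 1) / 2 ^ l) := by
    intro l
    rw [Real.closedBall_eq_Icc, one_div, inv_pow]
    congr 1 <;> field_simp <;> ring
  have hlim : Tendsto (fun l : ℕ => (1 / 2 : ℝ) * (1 / 2) ^ l) atTop (𝓝[>] 0) := by
    refine tendsto_nhdsWithin_iff.2 ⟨?_, Eventually.of_forall fun l => by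
      show (0 : ℝ) < 1 / 2 * (1 / 2) ^ l; positivity⟩
    have := (tendsto_pow_atTop_nhds_zero_of_lt_one (r := (1 / 2 : ℝ)) (by norm_num)
      (by norm_num)).const_mul (1 / 2)
    rwa [mul_zero] at this
  have := hx (fun l => ((k l : ℝ) + 1 / 2) / 2 ^ l) _ hlim (Eventually.of_forall fun l => by
    rw [one_mul, hball]; exact Set.Ioc_subset_Icc_self (hk l))
  rw [Set.indicator_of_mem hx01] at this
  refine this.congr fun l => ?_
  rw [hball, setAverage_eq, integral_Icc_eq_integral_Ioc, mass_eq_integral_indicator,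
    Real.volume_real_Icc_of_le (by gcongr; linarith), smul_eq_mul, dyadic]
  congr 1
  field_simp
  ring

lemma ae_abs_sub_average_le {f : ℝ → ℝ} {α R : ℝ} (hα : 0 < α) (hR : 0 ≤ R)
    (hH : f ∈ HolderBall α R) (hf : Integrable f lebUnit) :
    ∀ᵐ x ∂lebUnit, ∀ k : ℕ → ℕ, (∀ l, k l < 2 ^ l) → (∀ l, x ∈ dyadic l (k l)) → ∀ J,
      |2 ^ J * mass f J (k J) - f x| ≤ R * ((2 : ℝ) ^ (-α)) ^ J / (1 - (2 : ℝ) ^ (-α)) := by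
  filter_upwards [ae_tendsto_dyadic_average hf] with x hx k hk hxk J
  have h1 := hx k hxk
  have h2 : Tendsto (fun i => |2 ^ (J + i) * mass f (J + i) (k (J + i)) - 2 ^ J * mass f J (k J)|)
      atTop (𝓝 |f x - 2 ^ J * mass f J (k J)|) := by
    refine ((h1.comp (g := fun l => 2 ^ l * mass f l (k l)) (f := fun i => J + i) ?_).sub_const
      _).abs
    exact tendsto_atTop_mono (fun i => Nat.le_add_left i J) tendsto_id
  rw [abs_sub_comm]
  exact le_of_tendsto h2 (Eventually.of_forall fun i => abs_average_sub_le hα hR hH hf hk hxk J i)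

/-! ### Approximation by a tree with nearly correct splits -/

/-- Since `e^s (1 + z) ≤ e^{s+z}`, relative errors written as `e^s - 1` add in the exponent when one
more split is multiplied on. -/
lemma abs_mul_sub_mul_le {t q u p z s : ℝ} (hq : 0 ≤ q) (hp : 0 ≤ p) (hs : 0 ≤ s)
    (h1 : |t - q| ≤ q * (Real.exp s - 1)) (h2 : |u - p| ≤ p * z) :
    |t * u - q * p| ≤ q * p * (Real.exp (s + z) - 1) := by
  have hu : |u| ≤ p * (1 + z) := by
    have := abs_sub_abs_le_abs_sub u p
    rw [abs_of_nonneg hp] at this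
    linarith
  have he : 0 ≤ Real.exp s - 1 := by linarith [Real.add_one_le_exp s]
  calc |t * u - q * p| = |(t - q) * u + q * (u - p)| := by ring_nf
    _ ≤ |t - q| * |u| + q * |u - p| := by
        refine (abs_add_le _ _).trans ?_
        rw [abs_mul, abs_mul, abs_of_nonneg hq]
    _ ≤ q * (Real.exp s - 1) * (p * (1 + z)) + q * (p * z) := by gcongr
    _ = q * p * (Real.exp s * (1 + z) - 1) := by ring
    _ ≤ _ := by
        rw [Real.exp_add]
        have := Real.add_one_le_exp z
        gcongr
        linarith

/-- `Y` and `1 - Y` miss their targets by the same amount, so the hypothesis compares this one error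
with the conditional masses of both children (`i = 0, 1`). -/
lemma abs_treeMass_sub_mass_le {f : ℝ → ℝ} (hf : Integrable f lebUnit)
    (h1 : ∫ x, f x ∂lebUnit = 1) (hpos : ∀ l k, k < 2 ^ l → 0 < mass f l k) {L : ℕ}
    {y : Node L → ℝ} {J : ℕ} {z : ℕ → ℝ} (hz : ∀ j, 0 ≤ z j)
    (hy : ∀ l < J, ∀ k < 2 ^ l, ∀ i ≤ 1,
      |splitVar y l k - mass f (l + 1) (2 * k) / mass f l k| ≤
        mass f (l + 1) (2 * k + i) / mass f l k * z l)
    (l : ℕ) (hl : l ≤ J) : ∀ k < 2 ^ l, |treeMass y l k - mass f l k| ≤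
      mass f l k * (Real.exp (∑ j ∈ Finset.range l, z j) - 1) := by
  induction l with
  | zero =>
    intro k hk
    have : k = 0 := by simpa using hk
    subst this
    simp [treeMass, mass_zero h1]
  | succ l ih =>
    intro k hk
    have hk2 : k / 2 < 2 ^ l := by rw [pow_succ] at hk; omega
    have ih' := ih (by omega) (k / 2) hk2
    have hm := hpos l (k / 2) hk2
    have hm' := hpos (l + 1) k hk
    have e1 : mass f (l + 1) k = mass f l (k / 2) * (mass f (l + 1) k / mass f l (k / 2)) := by
      field_simp
    rw [Finset.sum_range_succ, treeMass, e1]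
    refine abs_mul_sub_mul_le hm.le (div_pos hm' hm).le (Finset.sum_nonneg fun j _ => hz j) ih' ?_
    rcases Nat.mod_two_eq_zero_or_one k with h | h
    · have e : 2 * (k / 2) = k := by omega
      have := hy l (by omega) (k / 2) hk2 0 (by omega)
      rw [add_zero, e] at this
      rw [if_pos h]
      exact this
    · have e : 2 * (k / 2) + 1 = k := by omega
      have := hy l (by omega) (k / 2) hk2 1 le_rfl
      have hs := mass_succ hf l (k / 2)
      rw [e] at this hs
      rw [if_neg (by omega)]
      have e2 : 1 - splitVar y l (k / 2) - mass f (l + 1) k / mass f l (k / 2) =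
          -(splitVar y l (k / 2) - mass f (l + 1) (2 * (k / 2)) / mass f l (k / 2)) := by
        rw [eq_sub_of_add_eq hs.symm]
        field_simp
        ring
      rw [e2, abs_neg]
      exact this

/-- Even splits leave the normalized height unchanged, so the tree density is a histogram at level
`J`. -/
lemma treeMass_of_split_half {L : ℕ} {y : Node L → ℝ} {J : ℕ}
    (hy : ∀ l, J ≤ l → ∀ k < 2 ^ l, splitVar y l k = 1 / 2) {x : ℝ} {k : ℕ → ℕ}
    (hk : ∀ l, k l < 2 ^ l) (hx : ∀ l, x ∈ dyadic l (k l)) (i : ℕ) :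
    2 ^ (J + i) * treeMass y (J + i) (k (J + i)) = 2 ^ J * treeMass y J (k J) := by
  induction i with
  | zero => simp
  | succ i ih =>
    have e : k (J + i + 1) / 2 = k (J + i) := dyadic_unique (mem_dyadic_half (hx _)) (hx _)
    have hs := hy (J + i) (by omega) (k (J + i)) (hk _)
    rw [← ih, ← add_assoc, treeMass, e, hs]
    split_ifs <;> ring

lemma ae_lebUnit_mem_Ioc : ∀ᵐ x ∂lebUnit, x ∈ Set.Ioc (0 : ℝ) 1 := by
  rw [lebUnit, ← restrict_Ioc_eq_restrict_Icc]
  exact ae_restrict_mem measurableSet_Ioc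

lemma supNorm_treeDensity_sub_le {f : ℝ → ℝ} {m₀ m₁ α R : ℝ} (hm₀ : 0 < m₀) (hm₁ : 0 < m₁)
    (hα : 0 < α) (hR : 0 ≤ R) (hH : f ∈ HolderBall α R) (hf : f ∈ BoundedDensities m₀ m₁)
    {L J : ℕ} (hJL : J ≤ L) {y : Node L → ℝ} {z : ℕ → ℝ} (hz : ∀ j, 0 ≤ z j)
    (hy1 : ∀ e : Node L, (e.1 : ℕ) < J →
      |y e - mass f (e.1 + 1) (2 * e.2) / mass f e.1 e.2| ≤ m₀ / (2 * m₁) * z e.1)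
    (hy2 : ∀ e : Node L, J ≤ (e.1 : ℕ) → y e = 1 / 2) :
    supNorm (fun t => treeDensity y t - f t) ≤
      ENNReal.ofReal (m₁ * (Real.exp (∑ j ∈ Finset.range J, z j) - 1) +
        R * ((2 : ℝ) ^ (-α)) ^ J / (1 - (2 : ℝ) ^ (-α))) := by
  have hpos : ∀ l k, k < 2 ^ l → 0 < mass f l k := fun l k hk =>
    lt_of_lt_of_le (by positivity) (mass_bounds hf hk).1
  have hs1 : ∀ l < J, ∀ k < 2 ^ l, ∀ i ≤ 1,
      |splitVar y l k - mass f (l + 1) (2 * k) / mass f l k| ≤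
        mass f (l + 1) (2 * k + i) / mass f l k * z l := by
    intro l hl k hk i hi
    rw [splitVar, dif_pos ⟨by omega, hk⟩]
    refine (hy1 ⟨⟨l, by omega⟩, ⟨k, hk⟩⟩ hl).trans ?_
    have h1 := (mass_bounds hf hk).2
    have h2 := (mass_bounds hf (l := l + 1) (k := 2 * k + i) (by rw [pow_succ]; omega)).1
    have h3 := hpos l k hk
    refine mul_le_mul_of_nonneg_right ?_ (hz l)
    -- This is a lower bound for the conditional mass of a child, turning an absolute error into a
    -- relative one.
    calc m₀ / (2 * m₁) = (m₀ / 2 ^ (l + 1)) / (m₁ / 2 ^ l) := by rw [pow_succ]; field_simp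
      _ ≤ _ := div_le_div₀ (le_trans (by positivity) h2) h2 h3 h1
  have hs2 : ∀ l, J ≤ l → ∀ k < 2 ^ l, splitVar y l k = 1 / 2 := by
    intro l hl k hk
    unfold splitVar
    split_ifs with h
    · exact hy2 ⟨⟨l, h.1⟩, ⟨k, h.2⟩⟩ hl
    · rfl
  rw [supNorm, eLpNorm_exponent_top]
  refine eLpNormEssSup_le_of_ae_bound ?_
  filter_upwards [ae_abs_sub_average_le hα hR hH hf.1, ae_lebUnit_mem_Ioc] with x hx hx01
  choose k hk hxk using fun l => exists_mem_dyadic l hx01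
  have e1 := treeDensity_eq y (hk L) (hxk L)
  obtain ⟨i, rfl⟩ := Nat.exists_eq_add_of_le hJL
  rw [treeMass_of_split_half hs2 hk hxk i] at e1
  have h1 := abs_treeMass_sub_mass_le hf.1 hf.2.1 hpos hz hs1 J le_rfl (k J) (hk J)
  have h2 := hx k hk hxk J
  have h3 := (mass_bounds hf (hk J)).2
  have hS : 0 ≤ Real.exp (∑ j ∈ Finset.range J, z j) - 1 := by
    have := Finset.sum_nonneg fun j (_ : j ∈ Finset.range J) => hz j
    linarith [Real.one_le_exp this]
  rw [e1, Real.norm_eq_abs]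
  refine (abs_sub_le _ (2 ^ J * mass f J (k J)) _).trans (add_le_add ?_ h2)
  rw [← mul_sub, abs_mul, abs_of_pos (by positivity)]
  calc (2 : ℝ) ^ J * |treeMass y J (k J) - mass f J (k J)|
      ≤ 2 ^ J * (m₁ / 2 ^ J * (Real.exp (∑ j ∈ Finset.range J, z j) - 1)) := by
        gcongr
        exact h1.trans (mul_le_mul_of_nonneg_right h3 hS)
    _ = _ := by field_simp

/-! ### Concentration of the counts -/

lemma densityLaw_real_dyadic {f : ℝ → ℝ} {m₀ m₁ : ℝ} (hm₀ : 0 < m₀)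
    (hf : f ∈ BoundedDensities m₀ m₁) (l k : ℕ) :
    (densityLaw f).real (dyadic l k) = mass f l k := by
  have h0 : 0 ≤ᵐ[lebUnit] f := hf.2.2.mono fun x hx => hm₀.le.trans hx.1
  rw [measureReal_def, densityLaw, withDensity_apply _ (measurableSet_dyadic l k),
    ← ofReal_integral_eq_lintegral_ofReal hf.1.integrableOn (ae_restrict_of_ae h0),
    ENNReal.toReal_ofReal (integral_nonneg_of_ae (ae_restrict_of_ae h0))]
  rfl

/-- From `1 + u ≤ e^u` and `e^t - 1 - t ≤ t^2`. The factor `q` in the exponent is essential: it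
makes the deviations of a count scale with the size of its interval. -/
lemma exp_mul_indicator_le {q t : ℝ} (hq : 0 ≤ q) (ht : |t| ≤ 1) :
    Real.exp (-(t * q)) * (1 + (Real.exp t - 1) * q) ≤ Real.exp (q * t ^ 2) := by
  have h1 := Real.add_one_le_exp ((Real.exp t - 1) * q)
  have h2 := (abs_le.1 (Real.abs_exp_sub_one_sub_id_le ht)).2
  calc Real.exp (-(t * q)) * (1 + (Real.exp t - 1) * q)
      ≤ Real.exp (-(t * q)) * Real.exp ((Real.exp t - 1) * q) := by gcongr; linarith
    _ = Real.exp (q * (Real.exp t - 1 - t)) := by rw [← Real.exp_add]; ring_nf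
    _ ≤ _ := by gcongr

lemma mgf_indicator_le {Ω : Type*} [MeasurableSpace Ω] {P : Measure Ω} [IsProbabilityMeasure P]
    {D : Set Ω} (hD : NullMeasurableSet D P) {t : ℝ} (ht : |t| ≤ 1) :
    mgf (fun ω => D.indicator 1 ω - P.real D) P t ≤ Real.exp (P.real D * t ^ 2) := by
  classical
  have h : ∀ ω, Real.exp (t * (D.indicator 1 ω - P.real D)) =
      Real.exp (-(t * P.real D)) * (1 + (Real.exp t - 1) * D.indicator 1 ω) := by
    intro ω
    by_cases hω : ω ∈ D
    · simp only [Set.indicator_of_mem hω, Pi.one_apply]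
      rw [mul_one, add_sub_cancel, ← Real.exp_add]; ring_nf
    · simp only [Set.indicator_of_notMem hω]
      ring_nf
  have hint : Integrable (D.indicator (1 : Ω → ℝ)) P :=
    (integrable_const (1 : ℝ)).indicator₀ hD
  unfold mgf
  simp_rw [h]
  rw [integral_const_mul, integral_add (integrable_const _) (hint.const_mul _),
    integral_const_mul, integral_indicator₀ hD]
  simp only [Pi.one_apply]
  rw [setIntegral_const]
  simp only [integral_const, probReal_univ, smul_eq_mul, mul_one]
  exact exp_mul_indicator_le measureReal_nonneg ht

/-- Bernstein-type tail bound for sums of independent indicators. -/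
lemma measureReal_abs_sum_indicator_ge {Ω : Type*} [MeasurableSpace Ω] {P : Measure Ω} [IsProbabilityMeasure P]
    {n : ℕ} {X : ℕ → Ω → ℝ} (hind : iIndepFun X P)
    (hX : ∀ i, AEMeasurable (X i) P) {D : Set ℝ} (hD : MeasurableSet D) {q v r : ℝ}
    (hq : ∀ i, P.real (X i ⁻¹' D) = q) (hqv : q ≤ v) (hr0 : 0 ≤ r) (hr : r ≤ 2 * (n * v))
    (hv : 0 < n * v) :
    P.real {ω | r ≤ |∑ i : Fin n, D.indicator (1 : ℝ → ℝ) (X i ω) - n * q|} ≤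
      2 * Real.exp (-(r ^ 2 / (4 * (n * v)))) := by
  set ξ : Fin n → Ω → ℝ := fun i ω => D.indicator (1 : ℝ → ℝ) (X i ω) - q with hξ
  have hφ : Measurable fun x => D.indicator (1 : ℝ → ℝ) x - q :=
    (measurable_one.indicator hD).sub_const q
  have hξi : iIndepFun ξ P :=
    (hind.precomp (g := fun i : Fin n => (i : ℕ)) Fin.val_injective).comp _ fun _ => hφ
  have hξm : ∀ i, AEMeasurable (ξ i) P := fun i => hφ.comp_aemeasurable (hX i)
  set S : Ω → ℝ := ∑ i, ξ i with hS
  have hSm : AEMeasurable S P := Finset.aemeasurable_sum _ fun i _ => hξm i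
  have hSeq : ∀ ω, S ω = ∑ i : Fin n, D.indicator (1 : ℝ → ℝ) (X i ω) - n * q := by
    intro ω; simp [hS, hξ, Finset.sum_apply]
  have hbound : ∀ ω, |S ω| ≤ n * (1 + |q|) := by
    intro ω
    rw [hS, Finset.sum_apply]
    refine (Finset.abs_sum_le_sum_abs _ _).trans ?_
    refine (Finset.sum_le_card_nsmul _ _ (1 + |q|) fun i _ => ?_).trans_eq (by simp [mul_add])
    refine (abs_sub _ _).trans ?_
    gcongr
    by_cases h : X i ω ∈ D <;> simp [h]
  have hint : ∀ t : ℝ, Integrable (fun ω => Real.exp (t * S ω)) P := by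
    intro t
    refine Integrable.of_bound (hSm.const_mul t).exp.aestronglyMeasurable
      (Real.exp (|t| * (n * (1 + |q|)))) (ae_of_all _ fun ω => ?_)
    rw [Real.norm_eq_abs, Real.abs_exp]
    refine Real.exp_le_exp.2 ((le_abs_self _).trans ?_)
    rw [abs_mul]
    exact mul_le_mul_of_nonneg_left (hbound ω) (abs_nonneg t)
  have hmgf : ∀ t : ℝ, |t| ≤ 1 → mgf S P t ≤ Real.exp (n * v * t ^ 2) := by
    intro t ht
    rw [hS, hξi.mgf_sum₀ hξm]
    calc ∏ i, mgf (ξ i) P t ≤ ∏ _i : Fin n, Real.exp (v * t ^ 2) := by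
          refine Finset.prod_le_prod (fun i _ => mgf_nonneg) fun i _ => ?_
          have := mgf_indicator_le (P := P) ((hX i).nullMeasurableSet_preimage hD) ht
          rw [hq] at this
          exact this.trans (by gcongr)
      _ = _ := by
          rw [Finset.prod_const, ← Real.exp_nat_mul]
          simp [mul_assoc]
  -- The minimizer of `-t r + n v t^2`; the assumption on `r` says exactly that `t ≤ 1`.
  set t := r / (2 * (n * v)) with ht
  have ht0 : 0 ≤ t := by positivity
  have ht1 : t ≤ 1 := (div_le_one (by positivity)).2 hr
  have hexp : Real.exp (-t * r) * Real.exp (n * v * t ^ 2) =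
      Real.exp (-(r ^ 2 / (4 * (n * v)))) := by
    rw [← Real.exp_add, ht]
    congr 1
    field_simp
    ring
  have up : P.real {ω | r ≤ S ω} ≤ Real.exp (-(r ^ 2 / (4 * (n * v)))) := by
    refine (measure_ge_le_exp_mul_mgf r ht0 (hint t)).trans ?_
    rw [← hexp]
    gcongr
    exact hmgf t (by rwa [abs_of_nonneg ht0])
  have low : P.real {ω | S ω ≤ -r} ≤ Real.exp (-(r ^ 2 / (4 * (n * v)))) := by
    refine (measure_le_le_exp_mul_mgf (-r) (neg_nonpos.2 ht0) (hint (-t))).trans ?_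
    rw [← hexp]
    have := hmgf (-t) (by rwa [abs_neg, abs_of_nonneg ht0])
    rw [neg_sq] at this
    rw [show - -t * -r = -t * r by ring]
    gcongr
  calc _ ≤ P.real ({ω | r ≤ S ω} ∪ {ω | S ω ≤ -r}) := by
        refine measureReal_mono fun ω hω => ?_
        simp only [Set.mem_ofPred_eq] at hω
        rw [← hSeq] at hω
        rcases le_abs.1 hω with h | h
        · exact Or.inl h
        · right; show S ω ≤ -r; linarith
    _ ≤ _ := (measureReal_union_le _ _).trans (by linarith)

lemma count_cast {n : ℕ} (x : Fin n → ℝ) (l k : ℕ) :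
    (count x l k : ℝ) = ∑ i, (dyadic l k).indicator (1 : ℝ → ℝ) (x i) := by
  classical
  unfold count
  push_cast
  refine Finset.sum_congr rfl fun i _ => ?_
  simp only [Set.indicator_apply, Pi.one_apply]
  split_ifs <;> simp

/-- All dyadic counts up to level `L` are close to their expectations. -/
def RegularSample (f : ℝ → ℝ) (m₁ : ℝ) (L : ℕ) {n : ℕ} (x : Fin n → ℝ) : Prop :=
  ∀ l ≤ L, ∀ k < 2 ^ l,
    |(count x l k : ℝ) - n * mass f l k| ≤ √(8 * m₁ * (n / 2 ^ l) * Real.log n)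

lemma measureReal_not_regularSample_le {Ω : Type*} [MeasurableSpace Ω] {P : Measure Ω} [IsProbabilityMeasure P]
    {f : ℝ → ℝ} {m₀ m₁ : ℝ} (hm₀ : 0 < m₀) (hm₁ : 0 < m₁)
    (hf : f ∈ BoundedDensities m₀ m₁) {X : ℕ → Ω → ℝ} (hind : iIndepFun X P)
    (hX : ∀ i, HasLaw (X i) (densityLaw f) P) {n L : ℕ} (hn : 1 ≤ n) (hL : 2 ^ L ≤ n)
    (hlog : ∀ l ≤ L, 2 * Real.log n ≤ m₁ * (n / 2 ^ l)) :
    P.real {ω | ¬ RegularSample f m₁ L (fun i : Fin n => X i ω)} ≤ 4 / n := by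
  have hn0 : (0 : ℝ) < n := by exact_mod_cast hn
  have hlog0 : 0 ≤ Real.log n := Real.log_natCast_nonneg n
  have h1 : ∀ l ≤ L, ∀ k < 2 ^ l, P.real {ω | √(8 * m₁ * (n / 2 ^ l) * Real.log n) ≤
      |(count (fun i : Fin n => X i ω) l k : ℝ) - n * mass f l k|} ≤ 2 / (n : ℝ) ^ 2 := by
    intro l hl k hk
    have hnv : 0 < n * (m₁ / 2 ^ l) := by positivity
    have := measureReal_abs_sum_indicator_ge (n := n) hind (fun i => (hX i).aemeasurable)
      (measurableSet_dyadic l k) (q := mass f l k) (v := m₁ / 2 ^ l)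
      (r := √(8 * m₁ * (n / 2 ^ l) * Real.log n)) (fun i => by
        rw [← densityLaw_real_dyadic hm₀ hf]
        exact (hX i).measureReal_eq (p := fun y => y ∈ dyadic l k) (measurableSet_dyadic l k))
      (mass_bounds hf hk).2 (Real.sqrt_nonneg _) (by
        rw [Real.sqrt_le_left (by positivity)]
        have h2 := hlog l hl
        have e : n * (m₁ / 2 ^ l) = m₁ * (n / 2 ^ l) := by ring
        rw [e] at hnv ⊢
        nlinarith) hnv
    simp_rw [count_cast]
    refine this.trans_eq ?_
    rw [Real.sq_sqrt (by positivity)]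
    -- The constant `8` gives failure probability `2/n^2` per interval; there are at most `2n`
    -- intervals.
    have e : 8 * m₁ * (n / 2 ^ l) * Real.log n / (4 * (n * (m₁ / 2 ^ l))) = 2 * Real.log n := by
      field_simp
      ring
    rw [e, Real.exp_neg, mul_comm 2 (Real.log n), Real.exp_mul, Real.exp_log hn0]
    norm_cast
  calc _ ≤ P.real (⋃ l ∈ Finset.range (L + 1), ⋃ k ∈ Finset.range (2 ^ l),
        {ω | √(8 * m₁ * (n / 2 ^ l) * Real.log n) ≤
          |(count (fun i : Fin n => X i ω) l k : ℝ) - n * mass f l k|}) := by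
        refine measureReal_mono (fun ω hω => ?_) (measure_ne_top _ _)
        simp only [RegularSample, Set.mem_ofPred_eq, not_forall, not_le] at hω
        obtain ⟨l, hl, k, hk, h⟩ := hω
        simp only [Set.mem_iUnion, Finset.mem_range]
        exact ⟨l, by omega, k, hk, h.le⟩
    _ ≤ ∑ l ∈ Finset.range (L + 1), ∑ k ∈ Finset.range (2 ^ l), 2 / (n : ℝ) ^ 2 := by
        refine (measureReal_biUnion_finset_le _ _).trans (Finset.sum_le_sum fun l hl => ?_)
        refine (measureReal_biUnion_finset_le _ _).trans (Finset.sum_le_sum fun k hk => ?_)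
        exact h1 l (by simpa [Nat.lt_succ_iff] using hl) k (Finset.mem_range.1 hk)
    _ = (∑ l ∈ Finset.range (L + 1), (2 : ℝ) ^ l) * (2 / (n : ℝ) ^ 2) := by
        rw [Finset.sum_mul]
        simp
    _ ≤ (2 * n) * (2 / (n : ℝ) ^ 2) := by
        have hL' : (2 : ℝ) ^ L ≤ n := by exact_mod_cast hL
        rw [geom_sum_eq (by norm_num), pow_succ]
        gcongr
        linarith
    _ = 4 / n := by field_simp; ring

lemma ae_mem_Ioc {Ω : Type*} [MeasurableSpace Ω] {P : Measure Ω} {f : ℝ → ℝ} {X : ℕ → Ω → ℝ} (hX : ∀ i, HasLaw (X i) (densityLaw f) P) :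
    ∀ᵐ ω ∂P, ∀ i, X i ω ∈ Set.Ioc (0 : ℝ) 1 := by
  refine ae_all_iff.2 fun i => ?_
  have h : ∀ᵐ x ∂densityLaw f, x ∈ Set.Ioc (0 : ℝ) 1 :=
    (withDensity_absolutelyContinuous _ _).ae_le ae_lebUnit_mem_Ioc
  rw [← (hX i).map_eq] at h
  exact ae_of_ae_map (hX i).aemeasurable h

/-! ### The truncation level -/

lemma le_cutoff {n J : ℕ} (h1 : 2 ^ J ≤ n) (h2 : 2 ^ J * J ^ 2 ≤ n) : J ≤ cutoff n :=
  Nat.le_findGreatest (Nat.le_log_of_pow_le one_lt_two h1) h2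

lemma pow_cutoff_mul_le (n : ℕ) : 2 ^ cutoff n * cutoff n ^ 2 ≤ n := by
  rcases Nat.eq_zero_or_pos (cutoff n) with h | h
  · simp [h]
  · exact Nat.findGreatest_of_ne_zero (m := cutoff n) rfl h.ne'

lemma pow_cutoff_le {n : ℕ} (hn : n ≠ 0) : 2 ^ cutoff n ≤ n :=
  Nat.pow_le_of_le_log hn (Nat.findGreatest_le _)

lemma cast_le_two_mul_log {J : ℕ} {x : ℝ} (h : 2 ^ J ≤ x) : (J : ℝ) ≤ 2 * Real.log x := by
  have h1 : Real.log (2 ^ J) ≤ Real.log x := Real.log_le_log (by positivity) h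
  rw [Real.log_pow] at h1
  have := Real.log_two_gt_d9
  nlinarith [Nat.cast_nonneg (α := ℝ) J]

lemma eventually_log_le_rpow {c s : ℝ} (hc : 0 < c) (hs : 0 < s) :
    ∀ᶠ n : ℕ in atTop, c * Real.log n ≤ (n : ℝ) ^ s := by
  have h := ((isLittleO_log_rpow_atTop hs).comp_tendsto tendsto_natCast_atTop_atTop).def
    (inv_pos.2 hc)
  filter_upwards [h, eventually_ge_atTop 1] with n hn h1
  have h0 : 0 ≤ Real.log n := Real.log_natCast_nonneg n
  simp only [Function.comp_apply, Real.norm_eq_abs, abs_of_nonneg h0,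
    abs_of_nonneg (Real.rpow_nonneg (Nat.cast_nonneg n) s)] at hn
  rwa [inv_mul_eq_div, le_div_iff₀' hc] at hn

lemma eventually_le_log (c : ℝ) : ∀ᶠ n : ℕ in atTop, c ≤ Real.log n :=
  (Real.tendsto_log_atTop.comp tendsto_natCast_atTop_atTop).eventually_ge_atTop c

lemma exists_pow_two_mem {X : ℝ} (hX : 1 ≤ X) : ∃ J : ℕ, X ≤ 2 ^ J ∧ 2 ^ J ≤ 2 * X := by
  have hX0 : 0 < X := by linarith
  have hlog : 0 ≤ Real.logb 2 X := Real.logb_nonneg (by norm_num) hX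
  refine ⟨⌈Real.logb 2 X⌉₊, ?_, ?_⟩
  · rw [← Real.rpow_natCast, ← Real.logb_le_iff_le_rpow (by norm_num) hX0]
    exact Nat.le_ceil _
  · have h := (Nat.ceil_lt_add_one hlog).le
    rw [← Real.rpow_natCast]
    calc (2 : ℝ) ^ ((⌈Real.logb 2 X⌉₊ : ℕ) : ℝ) ≤ 2 ^ (Real.logb 2 X + 1) :=
          Real.rpow_le_rpow_of_exponent_le (by norm_num) h
      _ = 2 * X := by
          rw [Real.rpow_add (by norm_num), Real.rpow_logb (by norm_num) (by norm_num) hX0,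
            Real.rpow_one, mul_comm]

lemma tendsto_rate {α : ℝ} (hα : 0 < α) : Tendsto (rate α) atTop (𝓝 0) := by
  have h : Tendsto (fun n : ℕ => Real.log n / n) atTop (𝓝 0) :=
    Real.isLittleO_log_id_atTop.tendsto_div_nhds_zero.comp tendsto_natCast_atTop_atTop
  have hs : 0 < α / (2 * α + 1) := by positivity
  have := h.rpow_const (p := α / (2 * α + 1)) (Or.inr hs.le)
  rwa [Real.zero_rpow hs.ne'] at this

/-- The resolution level at which bias and stochastic error balance. -/
lemma eventually_exists_level {α D : ℝ} (hα : 0 < α) (hα1 : α ≤ 1) (hD : 1 ≤ D) :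
    ∀ᶠ n : ℕ in atTop, ∃ J : ℕ, J ≤ cutoff n ∧ Real.log n / 4 ≤ J ∧
      D * ((((2 : ℝ) ^ (-α)) ^ J) ^ 2 * (n / 2 ^ J)) ≤ Real.log n ∧
      Real.log n * 2 ^ J / n ≤ 2 * D * rate α n ^ 2 ∧ ((2 : ℝ) ^ (-α)) ^ J ≤ rate α n := by
  set θ := 1 / (2 * α + 1) with hθ
  have hα2 : 0 < 2 * α + 1 := by linarith
  have hθ0 : 0 < θ := by positivity
  have hθ1 : θ < 1 := by rw [hθ, div_lt_one hα2]; linarith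
  -- Here `α ≤ 1` enters: it yields `2^J ≥ n^(1/4)`, hence `J ≥ log n / 4`, with a constant free of
  -- `α`.
  have hθ3 : 1 / 3 ≤ θ := by
    rw [hθ]; exact one_div_le_one_div_of_le hα2 (by linarith)
  have hs : 0 < (1 - θ) / 3 := by linarith
  filter_upwards [eventually_le_log (max 1 (4 * (4 * D) ^ 2)), eventually_log_le_rpow one_pos hs,
    eventually_log_le_rpow (show (0 : ℝ) < 1 by norm_num) (show (0 : ℝ) < 1 / 4 by norm_num),
    eventually_ge_atTop 1] with n hlog hlogs hlog4 hn
  have hn0 : (0 : ℝ) < n := by exact_mod_cast hn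
  have hn1 : (1 : ℝ) ≤ n := by exact_mod_cast hn
  set lam := Real.log n with hlam
  have hl1 : 1 ≤ lam := (le_max_left _ _).trans hlog
  have hlD : 4 * (4 * D) ^ 2 ≤ lam := (le_max_right _ _).trans hlog
  rw [one_mul] at hlogs hlog4
  have hl0 : 0 < lam := by linarith
  have hD0 : 0 < D := by linarith
  have hln : (n : ℝ) ^ (3 / 4 : ℝ) ≤ n / lam := by
    rw [le_div_iff₀ hl0]
    calc (n : ℝ) ^ (3 / 4 : ℝ) * lam ≤ (n : ℝ) ^ (3 / 4 : ℝ) * (n : ℝ) ^ (1 / 4 : ℝ) := by gcongr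
      _ = n := by rw [← Real.rpow_add hn0]; norm_num
  have hln1 : 1 ≤ n / lam := (Real.one_le_rpow hn1 (by norm_num)).trans hln
  -- Inflating `n / log n` by `D` deepens `J` enough for the squared bias to be `log n / D`; `D`
  -- will later absorb `R`.
  set V := D * (n / lam) with hV
  have hVn : n / lam ≤ V := le_mul_of_one_le_left (by positivity) hD
  have hV0 : 0 < V := by positivity
  have hXn : (n / lam) ^ θ ≤ V ^ θ := by gcongr
  have hX1 : 1 ≤ V ^ θ := (Real.one_le_rpow hln1 hθ0.le).trans hXn
  have hXD : V ^ θ ≤ D * (n / lam) ^ θ := by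
    rw [hV, Real.mul_rpow hD0.le (by positivity)]
    gcongr
    exact Real.rpow_le_self_of_one_le hD hθ1.le
  obtain ⟨J, hJ1, hJ2⟩ := exists_pow_two_mem hX1
  have hY0 : (0 : ℝ) < 2 ^ J := by positivity
  have hρ : ((2 : ℝ) ^ (-α)) ^ J = ((2 : ℝ) ^ J) ^ (-α) := by
    rw [← Real.rpow_natCast, ← Real.rpow_mul (by norm_num), mul_comm, Real.rpow_mul (by norm_num),
      Real.rpow_natCast]
  have hrate : rate α n = (n / lam) ^ (-(α * θ)) := by
    rw [rate, ← hlam, Real.rpow_neg (by positivity), ← Real.inv_rpow (by positivity), inv_div, hθ]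
    ring_nf
  have hrate2 : rate α n ^ 2 = lam / n * (n / lam) ^ θ := by
    rw [hrate, ← Real.rpow_natCast, ← Real.rpow_mul (by positivity), ← inv_div (n : ℝ) lam,
      ← Real.rpow_neg_one, ← Real.rpow_add (by positivity)]
    congr 1
    rw [hθ]
    push_cast
    field_simp
    ring
  have hlow : (n : ℝ) ^ (1 / 4 : ℝ) ≤ 2 ^ J := by
    refine le_trans ?_ (hXn.trans hJ1)
    calc (n : ℝ) ^ (1 / 4 : ℝ) = ((n : ℝ) ^ (3 / 4 : ℝ)) ^ (1 / 3 : ℝ) := by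
          rw [← Real.rpow_mul hn0.le]; norm_num
      _ ≤ (n / lam) ^ (1 / 3 : ℝ) := by gcongr
      _ ≤ _ := Real.rpow_le_rpow_of_exponent_le hln1 hθ3
  have hup : (2 : ℝ) ^ J ≤ 2 * D * (n : ℝ) ^ θ := by
    calc (2 : ℝ) ^ J ≤ 2 * (D * (n / lam) ^ θ) := hJ2.trans (by gcongr)
      _ ≤ 2 * (D * (n : ℝ) ^ θ) := by
          gcongr
          exact div_le_self hn0.le hl1
      _ = _ := by ring
  -- Two logarithms pay for `J^2` in the cutoff condition, the third for the constant `8 D`.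
  have hprod : lam ^ 3 * (n : ℝ) ^ θ ≤ (n : ℝ) := by
    calc lam ^ 3 * (n : ℝ) ^ θ ≤ ((n : ℝ) ^ ((1 - θ) / 3)) ^ 3 * (n : ℝ) ^ θ := by gcongr
      _ = (n : ℝ) := by
          rw [← Real.rpow_natCast, ← Real.rpow_mul hn0.le, ← Real.rpow_add hn0]
          norm_num
  have hup2 : (2 : ℝ) ^ J ≤ n := by
    refine hup.trans (le_trans ?_ hprod)
    gcongr
    have : lam ≤ lam ^ 3 := le_self_pow₀ hl1 (by norm_num)
    nlinarith
  have hJlog : (J : ℝ) ≤ 2 * lam := cast_le_two_mul_log hup2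
  have hcut : (2 : ℝ) ^ J * (J : ℝ) ^ 2 ≤ n := by
    calc (2 : ℝ) ^ J * (J : ℝ) ^ 2 ≤ 2 * D * (n : ℝ) ^ θ * (2 * lam) ^ 2 := by gcongr
      _ = 8 * D * lam ^ 2 * (n : ℝ) ^ θ := by ring
      _ ≤ lam ^ 3 * (n : ℝ) ^ θ := by
          gcongr
          have : 8 * D ≤ lam := by nlinarith
          calc 8 * D * lam ^ 2 ≤ lam * lam ^ 2 := by gcongr
            _ = _ := by ring
      _ ≤ n := hprod
  refine ⟨J, le_cutoff (by exact_mod_cast hup2) (by exact_mod_cast hcut), ?_, ?_, ?_, ?_⟩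
  · have h := Real.log_le_log (by positivity) hlow
    rw [Real.log_rpow hn0, Real.log_pow] at h
    have := Real.log_two_lt_d9
    nlinarith [Nat.cast_nonneg (α := ℝ) J]
  · rw [hρ]
    have e : (((2 : ℝ) ^ J) ^ (-α)) ^ 2 * (n / 2 ^ J) = n * ((2 : ℝ) ^ J) ^ (-(2 * α + 1)) := by
      rw [div_eq_mul_inv, ← Real.rpow_natCast (_ ^ (-α)), ← Real.rpow_mul hY0.le, mul_left_comm,
        ← Real.rpow_neg_one ((2 : ℝ) ^ J), ← Real.rpow_add hY0]
      push_cast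
      ring_nf
    have h2 : ((2 : ℝ) ^ J) ^ (-(2 * α + 1)) ≤ (V ^ θ) ^ (-(2 * α + 1)) :=
      Real.rpow_le_rpow_of_nonpos (by linarith) hJ1 (by linarith)
    rw [← Real.rpow_mul hV0.le, show θ * -(2 * α + 1) = -1 by rw [hθ]; field_simp,
      Real.rpow_neg_one] at h2
    rw [e]
    calc D * (n * ((2 : ℝ) ^ J) ^ (-(2 * α + 1))) ≤ D * (n * V⁻¹) := by gcongr
      _ = lam := by rw [hV]; field_simp
  · rw [hrate2]
    calc lam * 2 ^ J / n ≤ lam * (2 * (D * (n / lam) ^ θ)) / n := by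
          gcongr
          exact hJ2.trans (by gcongr)
      _ = _ := by ring
  · rw [hρ, hrate]
    calc ((2 : ℝ) ^ J) ^ (-α) ≤ ((n / lam) ^ θ) ^ (-α) :=
          Real.rpow_le_rpow_of_nonpos (by positivity) (hXn.trans hJ1) (by linarith)
      _ = _ := by rw [← Real.rpow_mul (by positivity)]; ring_nf

/-! ### The slab weights -/

/-- The terms `j = 0` and `j = l` of the normalizer, distinct as `1 ≤ l`, bound the slab odds by
`e^{-κ l}`; since `κ ≥ 0`, every term is at most one. -/
lemma expWeight_bounds {κ : ℝ} (hκ : 0 ≤ κ) {L l : ℕ} (hl : 1 ≤ l) (hlL : l ≤ L) :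
    0 ≤ expWeight κ L l ∧ expWeight κ L l ≤ 1 ∧
      expWeight κ L l ≤ Real.exp (-κ * l) * (1 - expWeight κ L l) ∧
      Real.exp (-κ * l) / (L + 1) ≤ expWeight κ L l := by
  unfold expWeight
  set E := Real.exp (-κ * l) with hE
  set S := ∑ j ∈ Finset.range (L + 1), Real.exp (-κ * j) with hS
  have hE0 : 0 < E := Real.exp_pos _
  have h1 : 1 + E ≤ S := by
    have hsub : ({0, l} : Finset ℕ) ⊆ Finset.range (L + 1) := by
      intro j hj
      simp only [Finset.mem_insert, Finset.mem_singleton] at hj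
      simp only [Finset.mem_range]
      omega
    have := Finset.sum_le_sum_of_subset_of_nonneg (f := fun j : ℕ => Real.exp (-κ * j)) hsub
      (fun j _ _ => (Real.exp_pos _).le)
    rw [Finset.sum_pair (by omega)] at this
    simpa [hE, hS] using this
  have h2 : S ≤ L + 1 := by
    refine (Finset.sum_le_card_nsmul _ _ 1 fun j _ => ?_).trans_eq (by simp)
    rw [Real.exp_le_one_iff]
    nlinarith [Nat.cast_nonneg (α := ℝ) j]
  have hS0 : 0 < S := by linarith
  refine ⟨by positivity, (div_le_one hS0).2 (by linarith), ?_, by gcongr⟩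
  rw [one_sub_div hS0.ne', mul_div_assoc']
  gcongr
  nlinarith

/-! ### Posterior contraction at the splits of a regular sample -/

lemma split_count_bounds {a b n q₀ q₁ w d m₀ m₁ : ℝ} (hn : 0 < n) (hw : 0 < w) (hm₀ : 0 < m₀)
    (h0 : |a - n * q₀| ≤ d) (h1 : |b - n * q₁| ≤ d)
    (h01 : |a + b - n * (q₀ + q₁)| ≤ d) (hq0 : m₀ * w / 2 ≤ n * q₀) (hq1 : m₀ * w / 2 ≤ n * q₁)
    (hq : n * (q₀ + q₁) ≤ m₁ * w) (hd : d ≤ m₀ * w / 4) :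
    m₀ * w / 4 ≤ a ∧ m₀ * w / 4 ≤ b ∧ a + b ≤ 2 * m₁ * w ∧
      |a / (a + b) - q₀ / (q₀ + q₁)| ≤ 4 * d / (m₀ * w) ∧
      |a - b| ≤ 2 * d + n * |q₁ - q₀| := by
  obtain ⟨h0l, h0u⟩ := abs_le.1 h0
  obtain ⟨h1l, h1u⟩ := abs_le.1 h1
  obtain ⟨hl, hu⟩ := abs_le.1 h01
  have hmw : 0 < m₀ * w := by positivity
  have ha : m₀ * w / 4 ≤ a := by linarith
  have hb : m₀ * w / 4 ≤ b := by linarith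
  have q0pos : 0 < q₀ := pos_of_mul_pos_right (by linarith : 0 < n * q₀) hn.le
  have q1pos : 0 < q₁ := pos_of_mul_pos_right (by linarith : 0 < n * q₁) hn.le
  refine ⟨ha, hb, by nlinarith, ?_, ?_⟩
  · have hN : 0 < a + b := by linarith
    have hQ : 0 < q₀ + q₁ := by linarith
    -- Both terms of the numerator are centred counts, so it is at most `2 d`.
    have e : a / (a + b) - q₀ / (q₀ + q₁) =
        ((a - n * q₀) - q₀ / (q₀ + q₁) * (a + b - n * (q₀ + q₁))) / (a + b) := by
      field_simp
      ring
    have hp : |q₀ / (q₀ + q₁)| ≤ 1 := by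
      rw [abs_of_pos (by positivity), div_le_one hQ]; linarith
    have hnum : |(a - n * q₀) - q₀ / (q₀ + q₁) * (a + b - n * (q₀ + q₁))| ≤ 2 * d := by
      refine (abs_sub _ _).trans ?_
      rw [abs_mul]
      have := mul_le_mul hp h01 (abs_nonneg _) zero_le_one
      linarith
    rw [e, abs_div, abs_of_pos hN]
    calc _ ≤ 2 * d / (m₀ * w / 2) :=
          div_le_div₀ ((abs_nonneg _).trans hnum) hnum (by positivity) (by linarith)
      _ = _ := by field_simp; ring
  · have e : a - b = (a - n * q₀) - (b - n * q₁) - n * (q₁ - q₀) := by ring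
    rw [e]
    refine (abs_sub _ _).trans ?_
    rw [abs_mul, abs_of_pos hn]
    have := abs_sub (a - n * q₀) (b - n * q₁)
    linarith

lemma RegularSample.split_bounds {f : ℝ → ℝ} {m₀ m₁ : ℝ} (hm₀ : 0 < m₀) (hm₁ : 0 < m₁)
    (hf : f ∈ BoundedDensities m₀ m₁) {n L : ℕ} (hn : 1 ≤ n) {x : Fin n → ℝ}
    (hx : RegularSample f m₁ L x) {l k : ℕ} (hl : l < L) (hk : k < 2 ^ l)
    (hw : 128 * m₁ * Real.log n ≤ m₀ ^ 2 * (n / 2 ^ l)) {a b : ℕ}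
    (ha : a = count x (l + 1) (2 * k)) (hb : b = count x (l + 1) (2 * k + 1)) :
    m₀ * (n / 2 ^ l) / 4 ≤ a ∧ m₀ * (n / 2 ^ l) / 4 ≤ b ∧ (a + b : ℝ) ≤ 2 * m₁ * (n / 2 ^ l) ∧
      |a / (a + b : ℝ) - mass f (l + 1) (2 * k) / mass f l k| ≤
        4 * √(8 * m₁ * (n / 2 ^ l) * Real.log n) / (m₀ * (n / 2 ^ l)) ∧
      |(a : ℝ) - b| ≤ 2 * √(8 * m₁ * (n / 2 ^ l) * Real.log n) +
        n * |mass f (l + 1) (2 * k + 1) - mass f (l + 1) (2 * k)| := by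
  have hn0 : (0 : ℝ) < n := by exact_mod_cast hn
  have hlog : 0 ≤ Real.log n := Real.log_natCast_nonneg n
  set w : ℝ := n / 2 ^ l with hwdef
  have hw0 : 0 < w := by positivity
  have hk0 : 2 * k < 2 ^ (l + 1) := by rw [pow_succ]; omega
  have hk1 : 2 * k + 1 < 2 ^ (l + 1) := by rw [pow_succ]; omega
  have hw2 : (n : ℝ) / 2 ^ (l + 1) = w / 2 := by rw [hwdef, pow_succ]; field_simp
  have hmono : √(8 * m₁ * (n / 2 ^ (l + 1)) * Real.log n) ≤ √(8 * m₁ * w * Real.log n) := by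
    rw [hw2]
    gcongr
    linarith
  have h01 := hx l hl.le k hk
  have hmass := mass_succ hf.1 l k
  rw [count_succ x l k, ← ha, ← hb, hmass, Nat.cast_add] at h01
  have hlow : ∀ j < 2 ^ (l + 1), m₀ * w / 2 ≤ n * mass f (l + 1) j := by
    intro j hj
    calc m₀ * w / 2 = n * (m₀ / 2 ^ (l + 1)) := by rw [hwdef, pow_succ]; field_simp
      _ ≤ _ := by gcongr; exact (mass_bounds hf hj).1
  rw [hmass]
  refine split_count_bounds hn0 hw0 hm₀
    (by rw [ha]; exact (hx (l + 1) hl _ hk0).trans hmono)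
    (by rw [hb]; exact (hx (l + 1) hl _ hk1).trans hmono) h01 (hlow _ hk0) (hlow _ hk1) ?_ ?_
  · rw [← hmass]
    calc n * mass f l k ≤ n * (m₁ / 2 ^ l) := by gcongr; exact (mass_bounds hf hk).2
      _ = m₁ * w := by rw [hwdef]; ring
  -- After squaring, `d ≤ m₀ w / 4` is the hypothesis `hw`, whence the `128`.
  · rw [Real.sqrt_le_left (by positivity)]
    nlinarith

lemma RegularSample.setLIntegral_far_le {f : ℝ → ℝ} {m₀ m₁ : ℝ} (hm₀ : 0 < m₀) (hm₁ : 0 < m₁)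
    (hf : f ∈ BoundedDensities m₀ m₁) {n L : ℕ} (hn : 1 ≤ n) (hL : 2 ^ L ≤ n) {x : Fin n → ℝ}
    (hx : RegularSample f m₁ L x) {l k : ℕ} (hl : l < L) (hk : k < 2 ^ l)
    (hw : 128 * m₁ * Real.log n ≤ m₀ ^ 2 * (n / 2 ^ l)) {κ s Γ K : ℝ} (hκ : 0 ≤ κ) (hs : 0 < s)
    (hΓ1 : 512 * m₁ / m₀ ^ 2 ≤ Γ) (hΓ2 : 16 * (5 + 2 * κ) / m₀ ≤ Γ)
    (hK : ∀ y, m₀ / (8 * m₁) / 2 ≤ y → y ≤ 1 - m₀ / (8 * m₁) / 2 → K ≤ betaPDFReal s s y)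
    (hKn : 4 ≤ K * n) (hhn : 1 / (2 * n : ℝ) ≤ m₀ / (8 * m₁) / 2) :
    ∫⁻ y in {y | |y - mass f (l + 1) (2 * k) / mass f l k| ≤
        √(Γ * (Real.log n / (n / 2 ^ l)))}ᶜ, ENNReal.ofReal (splitLik (count x (l + 1) (2 * k))
        (count x (l + 1) (2 * k + 1)) y) ∂spikeSlabLaw (expWeight κ L (l + 1)) s s ≤
      ENNReal.ofReal (1 / (n : ℝ) ^ 2) * ∫⁻ y, ENNReal.ofReal (splitLik (count x (l + 1) (2 * k))
        (count x (l + 1) (2 * k + 1)) y) ∂spikeSlabLaw (expWeight κ L (l + 1)) s s := by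
  have hn0 : (0 : ℝ) < n := by exact_mod_cast hn
  have hlog : 0 ≤ Real.log n := Real.log_natCast_nonneg n
  have hN : count x (l + 1) (2 * k) + count x (l + 1) (2 * k + 1) ≤ n := by
    rw [← count_succ]; exact count_le x l k
  generalize ha : count x (l + 1) (2 * k) = a at *
  generalize hb : count x (l + 1) (2 * k + 1) = b at *
  obtain ⟨hal, hbl, hab, hp, -⟩ := hx.split_bounds hm₀ hm₁ hf hn hl hk hw ha.symm hb.symm
  set w : ℝ := n / 2 ^ l with hwdef
  have hw0 : 0 < w := by positivity
  have ha0 : (0 : ℝ) < a := lt_of_lt_of_le (by positivity) hal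
  have hb0 : (0 : ℝ) < b := lt_of_lt_of_le (by positivity) hbl
  have hN' : (a + b : ℝ) ≤ n := by exact_mod_cast hN
  have hwt := expWeight_bounds hκ (Nat.succ_le_succ (Nat.zero_le l)) hl
  have hΓ0 : 0 ≤ Γ := le_trans (by positivity) hΓ1
  have hfrac : ∀ c : ℝ, m₀ * w / 4 ≤ c → m₀ / (8 * m₁) ≤ c / (a + b) := by
    intro c hc
    calc m₀ / (8 * m₁) = (m₀ * w / 4) / (2 * m₁ * w) := by field_simp; ring
      _ ≤ _ := div_le_div₀ (le_trans (by positivity) hc) hc (by positivity) hab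
  refine SpikeSlab.setLIntegral_far_le (by exact_mod_cast ha0) (by exact_mod_cast hb0) hs hwt.1
    hwt.2.1 (by positivity) (Real.sqrt_nonneg _) (p := (a : ℝ) / (a + b)) (c := m₀ / (8 * m₁))
    (h := 1 / (2 * n)) (K := K) rfl (hp.trans ?_) (hfrac a hal) ?_ (by positivity) hhn ?_ hK ?_
  · rw [div_le_div_iff₀ (by positivity) (by norm_num)]
    -- The empirical proportion is within `δ/2` of the truth; `512 = 8 * 8^2` comes from here.
    have h1 : √(8 * m₁ * w * Real.log n) * 8 ≤ √(Γ * (Real.log n / w)) * (m₀ * w) := by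
      have e1 : √(8 * m₁ * w * Real.log n) * 8 = √(512 * m₁ * w * Real.log n) := by
        rw [show 512 * m₁ * w * Real.log n = 8 * m₁ * w * Real.log n * 8 ^ 2 by ring,
          Real.sqrt_mul' _ (sq_nonneg 8), Real.sqrt_sq (by norm_num)]
      have e2 : √(Γ * (Real.log n / w)) * (m₀ * w) = √(Γ * m₀ ^ 2 * w * Real.log n) := by
        rw [show Γ * m₀ ^ 2 * w * Real.log n = Γ * (Real.log n / w) * (m₀ * w) ^ 2 by
          field_simp, Real.sqrt_mul' _ (sq_nonneg (m₀ * w)), Real.sqrt_sq (by positivity)]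
      rw [e1, e2]
      rw [div_le_iff₀ (by positivity)] at hΓ1
      gcongr
    linarith
  · have := hfrac b hbl
    have e : (1 : ℝ) - a / (a + b) = b / (a + b) := by field_simp; ring
    rwa [e]
  · rw [mul_one_div, div_le_div_iff₀ (by positivity) (by norm_num)]
    linarith
  · have hlL : ((l + 1 : ℕ) : ℝ) ≤ 2 * Real.log n :=
      cast_le_two_mul_log ((pow_le_pow_right₀ one_le_two (by omega : l + 1 ≤ L)).trans
        (by exact_mod_cast hL))
    have hLn : (L : ℝ) + 1 ≤ n := by
      have : L + 1 ≤ n := lt_of_lt_of_le Nat.lt_two_pow_self hL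
      exact_mod_cast this
    have hwt2 : Real.exp (-κ * (2 * Real.log n)) / n ≤ expWeight κ L (l + 1) := by
      refine le_trans ?_ hwt.2.2.2
      gcongr ?_ / ?_
      refine Real.exp_le_exp.2 ?_
      nlinarith
    rw [Real.sq_sqrt (by positivity)]
    -- Powers of `n` to be paid: `2κ` for `e^{-κ(l+1)}`, two for `1/n^2`, and one each for the
    -- normalizer `L + 1 ≤ n`, for `h = 1/(2n)`, and for `K` with the numerical factors.
    have hexp : (5 + 2 * κ) * Real.log n ≤ (a + b) * (Γ * (Real.log n / w)) / 8 := by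
      rw [div_le_iff₀ hm₀] at hΓ2
      calc (5 + 2 * κ) * Real.log n ≤ (Γ * m₀ / 16) * Real.log n := by gcongr; linarith
        _ = (m₀ * w / 2) * (Γ * (Real.log n / w)) / 8 := by field_simp; ring
        _ ≤ _ := by gcongr; linarith
    have hexpn : Real.exp (-Real.log n) = 1 / n := by
      rw [Real.exp_neg, Real.exp_log hn0, one_div]
    have hK0 : 0 < K := pos_of_mul_pos_left (by linarith : 0 < K * n) hn0.le
    calc Real.exp (-((a + b) * (Γ * (Real.log n / w)) / 8))
        ≤ Real.exp (-((5 + 2 * κ) * Real.log n)) := by gcongr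
      _ = Real.exp (-κ * (2 * Real.log n)) * (1 / n) ^ 5 := by
          rw [← hexpn, ← Real.exp_nat_mul, ← Real.exp_add]; push_cast; ring_nf
      _ = 1 / (n : ℝ) ^ 2 * (Real.exp (-κ * (2 * Real.log n)) / n) * 4 * (1 / (2 * n)) / 2 / n := by
          field_simp; norm_num
      _ ≤ 1 / (n : ℝ) ^ 2 * (expWeight κ L (l + 1)) * (K * n) * (1 / (2 * n)) / 2 / n := by
          have := hwt.1
          gcongr
      _ = _ := by field_simp

/-- The imbalance `a - b` consists of sampling noise and the Haar coefficient of `f`. Beyond level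
`J` the latter is bounded through `hbias` without `R`, so the threshold for `κ` depends on `m₀, m₁`
only. -/
lemma RegularSample.setLIntegral_spike_compl_le {f : ℝ → ℝ} {m₀ m₁ α R : ℝ} (hm₀ : 0 < m₀)
    (hm₁ : 0 < m₁) (hα : 0 < α) (hf : f ∈ BoundedDensities m₀ m₁) (hH : f ∈ HolderBall α R)
    {n L : ℕ} (hn : 1 ≤ n) {x : Fin n → ℝ}
    (hx : RegularSample f m₁ L x) {l k J : ℕ} (hl : l < L) (hk : k < 2 ^ l) (hJl : J ≤ l)
    (hw : 128 * m₁ * Real.log n ≤ m₀ ^ 2 * (n / 2 ^ l)) {κ s : ℝ} (hs : 0 < s)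
    (hκ : 512 * m₁ / m₀ + 24 ≤ κ) (hJ : Real.log n / 4 ≤ J)
    (hbias : R ^ 2 * ((((2 : ℝ) ^ (-α)) ^ J) ^ 2 * (n / 2 ^ J)) ≤ m₀ * Real.log n) :
    ∫⁻ y in {1 / 2}ᶜ, ENNReal.ofReal (splitLik (count x (l + 1) (2 * k))
        (count x (l + 1) (2 * k + 1)) y) ∂spikeSlabLaw (expWeight κ L (l + 1)) s s ≤
      ENNReal.ofReal (1 / (n : ℝ) ^ 2) * ∫⁻ y, ENNReal.ofReal (splitLik (count x (l + 1) (2 * k))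
        (count x (l + 1) (2 * k + 1)) y) ∂spikeSlabLaw (expWeight κ L (l + 1)) s s := by
  have hn0 : (0 : ℝ) < n := by exact_mod_cast hn
  have hlog : 0 ≤ Real.log n := Real.log_natCast_nonneg n
  have hκ0 : 0 ≤ κ := le_trans (by positivity) hκ
  generalize ha : count x (l + 1) (2 * k) = a at *
  generalize hb : count x (l + 1) (2 * k + 1) = b at *
  obtain ⟨hal, hbl, -, -, hdiff⟩ := hx.split_bounds hm₀ hm₁ hf hn hl hk hw ha.symm hb.symm
  have hms := abs_mass_sub_le hH hf.1 hk
  obtain ⟨hρ0, hρ1⟩ := rpow_neg_mem hα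
  set ρ := (2 : ℝ) ^ (-α) with hρ
  set w : ℝ := n / 2 ^ l with hwdef
  have hw0 : 0 < w := by positivity
  have ha0 : (0 : ℝ) < a := lt_of_lt_of_le (by positivity) hal
  have hb0 : (0 : ℝ) < b := lt_of_lt_of_le (by positivity) hbl
  have hwt := expWeight_bounds hκ0 (Nat.succ_le_succ (Nat.zero_le l)) hl
  refine SpikeSlab.setLIntegral_spike_compl_le (by exact_mod_cast ha0) (by exact_mod_cast hb0) hs
    hwt.1 (by positivity) ?_
  have hbias_l : R ^ 2 * ((ρ ^ l) ^ 2 * w) ≤ m₀ * Real.log n := by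
    refine le_trans ?_ hbias
    rw [hwdef]
    have h1 : ρ ^ l ≤ ρ ^ J := pow_le_pow_of_le_one hρ0.le hρ1.le hJl
    have h2 : (2 : ℝ) ^ J ≤ 2 ^ l := pow_le_pow_right₀ one_le_two hJl
    gcongr
  set d := √(8 * m₁ * w * Real.log n) with hd
  have hd2 : d ^ 2 = 8 * m₁ * w * Real.log n := Real.sq_sqrt (by positivity)
  have hdiff' : |(a : ℝ) - b| ≤ 2 * d + R * ρ ^ l * w := by
    refine hdiff.trans ?_
    have : n * |mass f (l + 1) (2 * k + 1) - mass f (l + 1) (2 * k)| ≤ n * (R * ρ ^ l / 2 ^ l) := by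
      gcongr
    have e : n * (R * ρ ^ l / 2 ^ l) = R * ρ ^ l * w := by rw [hwdef]; ring
    linarith
  have hsq : ((a : ℝ) - b) ^ 2 ≤ 64 * m₁ * w * Real.log n + 2 * m₀ * Real.log n * w := by
    calc ((a : ℝ) - b) ^ 2 = |(a : ℝ) - b| ^ 2 := (sq_abs _).symm
      _ ≤ (2 * d + R * ρ ^ l * w) ^ 2 := by gcongr
      _ ≤ 8 * d ^ 2 + 2 * (R ^ 2 * ((ρ ^ l) ^ 2 * w)) * w := by
          nlinarith [sq_nonneg (2 * d - R * ρ ^ l * w)]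
      _ ≤ 8 * (8 * m₁ * w * Real.log n) + 2 * (m₀ * Real.log n) * w := by rw [hd2]; gcongr
      _ = _ := by ring
  have hchi : ((a : ℝ) - b) ^ 2 / (a + b) ≤ (128 * m₁ / m₀ + 4) * Real.log n := by
    calc ((a : ℝ) - b) ^ 2 / (a + b)
        ≤ (64 * m₁ * w * Real.log n + 2 * m₀ * Real.log n * w) / (m₀ * w / 2) := by
          gcongr; linarith
      _ = _ := by field_simp; ring
  have hE : Real.exp (-κ * (l + 1 : ℕ)) * Real.exp (((a : ℝ) - b) ^ 2 / (a + b)) ≤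
      1 / (n : ℝ) ^ 2 := by
    have e : 1 / (n : ℝ) ^ 2 = Real.exp (-(2 * Real.log n)) := by
      rw [Real.exp_neg, mul_comm, Real.exp_mul, Real.exp_log hn0, one_div]; norm_cast
    rw [e, ← Real.exp_add]
    refine Real.exp_le_exp.2 ?_
    have hl' : Real.log n / 4 ≤ (l + 1 : ℕ) := hJ.trans (by exact_mod_cast (by omega))
    have h1 : κ * (Real.log n / 4) ≤ κ * (l + 1 : ℕ) := by gcongr
    -- The threshold is `4 (128 m₁/m₀ + 4 + 2)`: the `4` in front offsets `l ≥ log n / 4`, and the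
    -- `2` produces `1/n^2`.
    have h2 : (512 * m₁ / m₀ + 24) * (Real.log n / 4) ≤ κ * (Real.log n / 4) := by gcongr
    have h3 : (512 * m₁ / m₀ + 24) * (Real.log n / 4) =
      (128 * m₁ / m₀ + 4) * Real.log n + 2 * Real.log n := by ring
    linarith
  have h1w : 0 ≤ 1 - expWeight κ L (l + 1) := by linarith [hwt.2.1]
  calc _ ≤ Real.exp (-κ * (l + 1 : ℕ)) * (1 - expWeight κ L (l + 1)) *
        Real.exp (((a : ℝ) - b) ^ 2 / (a + b)) := by gcongr; exact hwt.2.2.1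
    _ = Real.exp (-κ * (l + 1 : ℕ)) * Real.exp (((a : ℝ) - b) ^ 2 / (a + b)) *
        (1 - expWeight κ L (l + 1)) := by ring
    _ ≤ _ := by gcongr

/-! ### Posterior contraction in the supremum norm -/

/-- The errors grow geometrically with depth, so their sum has the order of the last one and no
logarithm is lost. -/
lemma sum_sqrt_two_pow_le (J : ℕ) : ∑ j ∈ Finset.range J, √2 ^ j ≤ 3 * √2 ^ J := by
  have h : 4 / 3 ≤ √2 := by rw [Real.le_sqrt' (by norm_num)]; norm_num
  rw [geom_sum_eq (by linarith), div_le_iff₀ (by linarith)]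
  have : 0 < √2 ^ J := by positivity
  nlinarith

lemma sum_sqrt_le {Γ t r : ℝ} (n J : ℕ) (hΓ : 0 ≤ Γ) (hr : 0 ≤ r)
    (ht : Real.log n * 2 ^ J / n ≤ t * r ^ 2) :
    ∑ j ∈ Finset.range J, √(Γ * (Real.log n / (n / 2 ^ j))) ≤ 3 * √(Γ * t) * r := by
  have hlog : 0 ≤ Real.log n := Real.log_natCast_nonneg n
  have e : ∀ j : ℕ, √(Γ * (Real.log n / (n / 2 ^ j))) = √(Γ * (Real.log n / n)) * √2 ^ j := by
    intro j
    have h2 : √2 ^ j = √(2 ^ j) := by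
      rw [← Real.sqrt_sq (show 0 ≤ √2 ^ j by positivity), ← pow_mul, mul_comm j 2, pow_mul,
        Real.sq_sqrt (by norm_num)]
    rw [h2, ← Real.sqrt_mul (by positivity)]
    congr 1
    rw [div_div_eq_mul_div]
    ring
  simp_rw [e]
  rw [← Finset.mul_sum]
  calc _ ≤ √(Γ * (Real.log n / n)) * (3 * √2 ^ J) := by gcongr; exact sum_sqrt_two_pow_le J
    _ = 3 * √(Γ * (Real.log n / (n / 2 ^ J))) := by rw [e]; ring
    _ ≤ 3 * √(Γ * t * r ^ 2) := by
        rw [div_div_eq_mul_div, mul_assoc Γ t]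
        gcongr
    _ = _ := by rw [Real.sqrt_mul' _ (sq_nonneg r), Real.sqrt_sq hr]; ring

lemma one_sub_le_posteriorBall {f : ℝ → ℝ} {m₀ m₁ α R : ℝ} (hm₀ : 0 < m₀) (hm₁ : 0 < m₁)
    (hα : 0 < α) (hR : 0 < R) (hf : f ∈ BoundedDensities m₀ m₁) (hH : f ∈ HolderBall α R)
    {n : ℕ} (hn : 1 ≤ n) {x : Fin n → ℝ} (hx : RegularSample f m₁ (cutoff n) x)
    (hx01 : ∀ i, x i ∈ Set.Ioc (0 : ℝ) 1) {a J : ℕ} (ha : 1 ≤ a) {κ Γ K D M : ℝ}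
    (hw : ∀ l ≤ cutoff n, 128 * m₁ * Real.log n ≤ m₀ ^ 2 * (n / 2 ^ l))
    (hκ : 512 * m₁ / m₀ + 24 ≤ κ)
    (hΓ1 : 512 * m₁ / m₀ ^ 2 ≤ Γ) (hΓ2 : 16 * (5 + 2 * κ) / m₀ ≤ Γ)
    (hK : ∀ y, m₀ / (8 * m₁) / 2 ≤ y → y ≤ 1 - m₀ / (8 * m₁) / 2 → K ≤ betaPDFReal a a y)
    (hKn : 4 ≤ K * n) (hhn : 1 / (2 * n : ℝ) ≤ m₀ / (8 * m₁) / 2)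
    (hRD : R ^ 2 ≤ m₀ * D)
    (hJL : J ≤ cutoff n) (hJ : Real.log n / 4 ≤ J)
    (hbias : D * ((((2 : ℝ) ^ (-α)) ^ J) ^ 2 * (n / 2 ^ J)) ≤ Real.log n)
    (hvar : Real.log n * 2 ^ J / n ≤ 2 * D * rate α n ^ 2)
    (hrate : ((2 : ℝ) ^ (-α)) ^ J ≤ rate α n)
    (hsmall : 2 * m₁ / m₀ * (3 * √(Γ * (2 * D)) * rate α n) ≤ 1)
    (hM : m₁ * (2 * (2 * m₁ / m₀ * (3 * √(Γ * (2 * D))))) + R / (1 - (2 : ℝ) ^ (-α)) ≤ M) :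
    1 - 1 / n ≤ posteriorBall a κ n f (M * rate α n) x ∧
      posteriorBall a κ n f (M * rate α n) x ≤ 1 := by
  have hn0 : (0 : ℝ) < n := by exact_mod_cast hn
  have hlog : 0 ≤ Real.log n := Real.log_natCast_nonneg n
  have hκ0 : 0 ≤ κ := le_trans (by positivity) hκ
  have hΓ0 : 0 ≤ Γ := le_trans (by positivity) hΓ1
  have ha0 : (0 : ℝ) < a := by exact_mod_cast ha
  obtain ⟨hρ0, hρ1⟩ := rpow_neg_mem hα
  have hrate0 : 0 ≤ rate α n := le_trans (by positivity) hrate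
  have hL : 2 ^ cutoff n ≤ n := pow_cutoff_le (by omega)
  set δ : ℕ → ℝ := fun l => √(Γ * (Real.log n / (n / 2 ^ l))) with hδ
  set z : ℕ → ℝ := fun l => 2 * m₁ / m₀ * δ l with hz
  have hz0 : ∀ j, 0 ≤ z j := fun j => by positivity
  have hsum : ∑ j ∈ Finset.range J, z j ≤ 2 * m₁ / m₀ * (3 * √(Γ * (2 * D)) * rate α n) := by
    rw [hz, ← Finset.mul_sum]
    gcongr
    exact sum_sqrt_le n J hΓ0 hrate0 hvar
  have hsum0 : 0 ≤ ∑ j ∈ Finset.range J, z j := Finset.sum_nonneg fun j _ => hz0 j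
  have hexp : Real.exp (∑ j ∈ Finset.range J, z j) - 1 ≤
      2 * (2 * m₁ / m₀ * (3 * √(Γ * (2 * D)) * rate α n)) := by
    -- `|e^u - 1| ≤ 2|u|` holds for `|u| ≤ 1`; `hsmall` provides this range.
    have := Real.abs_exp_sub_one_le (x := ∑ j ∈ Finset.range J, z j)
      (by rw [abs_of_nonneg hsum0]; exact hsum.trans hsmall)
    rw [abs_of_nonneg hsum0] at this
    linarith [le_abs_self (Real.exp (∑ j ∈ Finset.range J, z j) - 1)]
  have hbias' : R ^ 2 * ((((2 : ℝ) ^ (-α)) ^ J) ^ 2 * (n / 2 ^ J)) ≤ m₀ * Real.log n := by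
    calc _ ≤ m₀ * D * ((((2 : ℝ) ^ (-α)) ^ J) ^ 2 * (n / 2 ^ J)) := by gcongr
      _ = m₀ * (D * ((((2 : ℝ) ^ (-α)) ^ J) ^ 2 * (n / 2 ^ J))) := by ring
      _ ≤ _ := by gcongr
  set ν : Node (cutoff n) → Measure ℝ := fun e =>
    spikeSlabLaw (expWeight κ (cutoff n) (e.1 + 1)) a a with hν
  have hprob : ∀ e, IsProbabilityMeasure (ν e) := fun e =>
    have h := expWeight_bounds hκ0 (Nat.succ_le_succ (Nat.zero_le e.1)) (Nat.succ_le_of_lt e.1.2)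
    isProbabilityMeasure_spikeSlabLaw h.1 h.2.1 ha0
  set A : Node (cutoff n) → Set ℝ := fun e => if (e.1 : ℕ) < J then
    {y | |y - mass f (e.1 + 1) (2 * e.2) / mass f e.1 e.2| ≤ δ e.1} else {1 / 2} with hA
  have hAm : ∀ e, MeasurableSet (A e) := by
    intro e
    simp only [hA]
    split_ifs
    · exact measurableSet_le (by fun_prop) measurable_const
    · exact measurableSet_singleton _
  have key := one_sub_le_bayesPosterior_real ν (fun e => ae_spikeSlabLaw_mem_Ioo _ _ _) hx01 hAm
    (η := 1 / (n : ℝ) ^ 2) (by positivity) (fun e => by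
      simp only [hA]
      split_ifs with he
      · exact hx.setLIntegral_far_le hm₀ hm₁ hf hn hL e.1.2 e.2.2 (hw _ e.1.2.le) hκ0 ha0 hΓ1 hΓ2
          hK hKn hhn
      · exact hx.setLIntegral_spike_compl_le hm₀ hm₁ hα hf hH hn e.1.2 e.2.2 (not_lt.1 he)
          (hw _ e.1.2.le) ha0 hκ hJ hbias')
    (S := {y | supNorm (fun t => treeDensity y t - f t) ≤ ENNReal.ofReal (M * rate α n)}) (by
      intro y hy
      refine (supNorm_treeDensity_sub_le hm₀ hm₁ hα hR.le hH hf hJL hz0 (fun e he => ?_)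
        (fun e he => ?_)).trans (ENNReal.ofReal_le_ofReal ?_)
      · have := hy e
        simp only [hA, if_pos he] at this
        refine this.trans_eq ?_
        rw [hz]
        field_simp
      · have := hy e
        simp only [hA, if_neg (not_lt.2 he)] at this
        exact this
      · have h1 : 0 < 1 - (2 : ℝ) ^ (-α) := by linarith
        calc _ ≤ m₁ * (2 * (2 * m₁ / m₀ * (3 * √(Γ * (2 * D)) * rate α n))) +
              R * rate α n / (1 - (2 : ℝ) ^ (-α)) := by gcongr
          _ = (m₁ * (2 * (2 * m₁ / m₀ * (3 * √(Γ * (2 * D))))) + R / (1 - (2 : ℝ) ^ (-α))) *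
              rate α n := by ring
          _ ≤ _ := by gcongr)
  refine ⟨le_trans ?_ key.1, key.2⟩
  have hcard : (Fintype.card (Node (cutoff n)) : ℝ) ≤ n := by exact_mod_cast card_node_le hL
  have : (Fintype.card (Node (cutoff n)) : ℝ) * (1 / (n : ℝ) ^ 2) ≤ 1 / n := by
    calc _ ≤ (n : ℝ) * (1 / (n : ℝ) ^ 2) := by gcongr
      _ = 1 / n := by field_simp
  linarith

/-- The factor `L^2` in the cutoff is used here. With `L ≥ J ≥ log n / 4` it gives `n / 2^l ≥ (log
n)^2 / 16` for `l ≤ L`, so even the deepest intervals expect far more than `log n` points. -/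
lemma eventually_mul_log_le {m₀ m₁ α D : ℝ} (hm₀ : 0 < m₀) (hm₁ : 0 < m₁) (hα : 0 < α)
    (hα1 : α ≤ 1) (hD : 1 ≤ D) :
    ∀ᶠ n : ℕ in atTop, ∀ l ≤ cutoff n, 128 * m₁ * Real.log n ≤ m₀ ^ 2 * (n / 2 ^ l) ∧
      2 * Real.log n ≤ m₁ * (n / 2 ^ l) := by
  filter_upwards [eventually_exists_level hα hα1 hD,
    eventually_le_log (16 * (128 * m₁ / m₀ ^ 2 + 2 / m₁))] with n ⟨J, hJL, hJ, _⟩ hlog l hl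
  have hlog0 : 0 ≤ Real.log n := Real.log_natCast_nonneg n
  have hcut : (2 : ℝ) ^ cutoff n * (cutoff n : ℝ) ^ 2 ≤ n := by
    exact_mod_cast pow_cutoff_mul_le n
  have hpow : (2 : ℝ) ^ l ≤ 2 ^ cutoff n := pow_le_pow_right₀ one_le_two hl
  have hJL' : (J : ℝ) ≤ cutoff n := by exact_mod_cast hJL
  have key : (128 * m₁ / m₀ ^ 2 + 2 / m₁) * Real.log n ≤ n / 2 ^ l := by
    rw [le_div_iff₀ (by positivity)]
    refine le_trans ?_ hcut
    rw [mul_comm]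
    have h1 : Real.log n / 4 ≤ cutoff n := hJ.trans hJL'
    have h2 : (Real.log n / 4) ^ 2 ≤ (cutoff n : ℝ) ^ 2 := by gcongr
    have h3 : (128 * m₁ / m₀ ^ 2 + 2 / m₁) * Real.log n ≤ (Real.log n / 4) ^ 2 := by nlinarith
    have h4 := h3.trans h2
    gcongr
  rw [add_mul] at key
  have h1 : 0 ≤ 128 * m₁ / m₀ ^ 2 * Real.log n := by positivity
  have h2 : 0 ≤ 2 / m₁ * Real.log n := by positivity
  constructor
  · calc 128 * m₁ * Real.log n = m₀ ^ 2 * (128 * m₁ / m₀ ^ 2 * Real.log n) := by field_simp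
      _ ≤ _ := by gcongr; linarith
  · calc 2 * Real.log n = m₁ * (2 / m₁ * Real.log n) := by field_simp
      _ ≤ _ := by gcongr; linarith

lemma eventually_one_sub_le_posteriorBall {f : ℝ → ℝ} {m₀ m₁ α R : ℝ} (hm₀ : 0 < m₀) (hm₁ : 0 < m₁)
    (hα : 0 < α) (hα1 : α ≤ 1) (hR : 0 < R) (hf : f ∈ BoundedDensities m₀ m₁)
    (hH : f ∈ HolderBall α R) {a : ℕ} (ha : 1 ≤ a) {κ Γ D M : ℝ}
    (hκ : 512 * m₁ / m₀ + 24 ≤ κ)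
    (hΓ1 : 512 * m₁ / m₀ ^ 2 ≤ Γ) (hΓ2 : 16 * (5 + 2 * κ) / m₀ ≤ Γ) (hD : 1 ≤ D)
    (hRD : R ^ 2 ≤ m₀ * D)
    (hM : m₁ * (2 * (2 * m₁ / m₀ * (3 * √(Γ * (2 * D))))) + R / (1 - (2 : ℝ) ^ (-α)) ≤ M) :
    ∀ᶠ n : ℕ in atTop, ∀ x : Fin n → ℝ, RegularSample f m₁ (cutoff n) x →
      (∀ i, x i ∈ Set.Ioc (0 : ℝ) 1) →
      1 - 1 / n ≤ posteriorBall a κ n f (M * rate α n) x ∧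
        posteriorBall a κ n f (M * rate α n) x ≤ 1 := by
  obtain ⟨K, hK0, hK⟩ := exists_betaPDFReal_lower (s := a) (c := m₀ / (8 * m₁) / 2)
    (by exact_mod_cast ha) (by positivity)
  have hsmall : ∀ᶠ n : ℕ in atTop, 2 * m₁ / m₀ * (3 * √(Γ * (2 * D)) * rate α n) ≤ 1 := by
    have := ((tendsto_rate hα).const_mul (3 * √(Γ * (2 * D)))).const_mul (2 * m₁ / m₀)
    rw [mul_zero, mul_zero] at this
    exact this.eventually_le_const one_pos
  have hKn : ∀ᶠ n : ℕ in atTop, 4 ≤ K * n :=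
    (tendsto_natCast_atTop_atTop.const_mul_atTop hK0).eventually_ge_atTop 4
  have hhn : ∀ᶠ n : ℕ in atTop, 1 / (2 * n : ℝ) ≤ m₀ / (8 * m₁) / 2 :=
    (tendsto_const_nhds.div_atTop (tendsto_natCast_atTop_atTop.const_mul_atTop
      two_pos)).eventually_le_const (by positivity)
  filter_upwards [hsmall, hKn, hhn, eventually_ge_atTop 1, eventually_exists_level hα hα1 hD,
    eventually_mul_log_le hm₀ hm₁ hα hα1 hD] with n h1 h2 h3 h4 ⟨J, hJL, hJ, hb, hv, hr⟩ hw x hx hx01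
  exact one_sub_le_posteriorBall hm₀ hm₁ hα hR hf hH h4 hx hx01 ha (fun l hl => (hw l hl).1) hκ
    hΓ1 hΓ2 hK h2 h3 hRD hJL hJ hb hv hr h1 hM

lemma tendstoInMeasure_posteriorBall {Ω : Type*} [MeasurableSpace Ω] {P : Measure Ω}
    [IsProbabilityMeasure P] {f : ℝ → ℝ} {m₀ m₁ α R : ℝ} (hm₀ : 0 < m₀) (hm₁ : 0 < m₁)
    (hα : 0 < α) (hα1 : α ≤ 1) (hR : 0 < R) (hf : f ∈ BoundedDensities m₀ m₁)
    (hH : f ∈ HolderBall α R) {a : ℕ} (ha : 1 ≤ a) {κ Γ D M : ℝ}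
    (hκ : 512 * m₁ / m₀ + 24 ≤ κ)
    (hΓ1 : 512 * m₁ / m₀ ^ 2 ≤ Γ) (hΓ2 : 16 * (5 + 2 * κ) / m₀ ≤ Γ) (hD : 1 ≤ D)
    (hRD : R ^ 2 ≤ m₀ * D)
    (hM : m₁ * (2 * (2 * m₁ / m₀ * (3 * √(Γ * (2 * D))))) + R / (1 - (2 : ℝ) ^ (-α)) ≤ M)
    {X : ℕ → Ω → ℝ} (hind : iIndepFun X P) (hX : ∀ i, HasLaw (X i) (densityLaw f) P) :
    TendstoInMeasure P (fun (n : ℕ) (ω : Ω) =>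
      posteriorBall a κ n f (M * rate α n) (fun i : Fin n => X i ω)) atTop (fun _ => (1 : ℝ)) := by
  intro ε hε
  have hlim : ∀ c : ℝ, Tendsto (fun n : ℕ => ENNReal.ofReal (c / n)) atTop (𝓝 0) := fun c => by
    have := ENNReal.tendsto_ofReal (tendsto_const_div_atTop_nhds_zero_nat c)
    rwa [ENNReal.ofReal_zero] at this
  refine tendsto_of_tendsto_of_tendsto_of_le_of_le' tendsto_const_nhds (hlim 4)
    (Eventually.of_forall fun _ => zero_le) ?_
  filter_upwards [(hlim 1).eventually_lt_const hε, eventually_ge_atTop 1,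
    eventually_mul_log_le hm₀ hm₁ hα hα1 hD,
    eventually_one_sub_le_posteriorBall hm₀ hm₁ hα hα1 hR hf hH ha hκ hΓ1 hΓ2 hD hRD hM]
    with n hnε hn hw hpost
  have hsub : {ω | ε ≤ edist (posteriorBall a κ n f (M * rate α n) (fun i : Fin n => X i ω)) 1} ⊆
      {ω | ¬ RegularSample f m₁ (cutoff n) (fun i : Fin n => X i ω)} ∪
        {ω | ¬ ∀ i, X i ω ∈ Set.Ioc (0 : ℝ) 1} := by
    intro ω hω
    by_contra hcon
    simp only [Set.mem_union, Set.mem_ofPred_eq, not_or, not_not] at hcon hω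
    obtain ⟨h1, h2⟩ := hpost _ hcon.1 fun i => hcon.2 i
    refine absurd hω (not_le.2 (lt_of_le_of_lt ?_ hnε))
    rw [edist_dist, Real.dist_eq]
    have hn0 : (0 : ℝ) ≤ 1 / n := by positivity
    exact ENNReal.ofReal_le_ofReal (abs_le.2 ⟨by linarith, by linarith⟩)
  have hnull : P {ω | ¬ ∀ i, X i ω ∈ Set.Ioc (0 : ℝ) 1} = 0 := ae_mem_Ioc hX
  calc _ ≤ P {ω | ¬ RegularSample f m₁ (cutoff n) (fun i : Fin n => X i ω)} + 0 :=
        (measure_mono hsub).trans ((measure_union_le _ _).trans_eq (by rw [hnull]))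
    _ ≤ ENNReal.ofReal (4 / n) := by
        rw [add_zero, ← ofReal_measureReal]
        exact ENNReal.ofReal_le_ofReal (measureReal_not_regularSample_le hm₀ hm₁ hf hind hX hn
          (pow_cutoff_le (by omega)) fun l hl => (hw l hl).2)

end SpikeSlab

end

theorem theorem2 (m₀ m₁ : ℝ) (hm₀ : 0 < m₀) (hm₁ : 0 < m₁) :
    ∃ κ₀ : ℝ, ∀ κ : ℝ, κ₀ ≤ κ →
      ∀ (a : ℕ), 1 ≤ a → ∀ α R : ℝ, 0 < α → α ≤ 1 → 0 < R →
        ∃ M₀ : ℝ, ∀ M : ℝ, M₀ ≤ M →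
          ∀ f₀ ∈ SpikeSlab.HolderBall α R ∩ SpikeSlab.BoundedDensities m₀ m₁,
          ∀ (Ω : Type*) [MeasurableSpace Ω] (P : Measure Ω) [IsProbabilityMeasure P]
            (X : ℕ → Ω → ℝ), iIndepFun X P →
            (∀ i, HasLaw (X i) (SpikeSlab.densityLaw f₀) P) →
            TendstoInMeasure P
              (fun (n : ℕ) (ω : Ω) =>
                SpikeSlab.posteriorBall a κ n f₀ (M * SpikeSlab.rate α n)
                  (fun i : Fin n => X i ω))
              atTop (fun _ => (1 : ℝ)) := by
  refine ⟨512 * m₁ / m₀ + 24, fun κ hκ a ha α R hα hα1 hR => ?_⟩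
  have hκ0 : 0 ≤ κ := le_trans (by positivity) hκ
  -- `M₀` is read off from `hM` by unification. `Γ` is the sum of its two lower bounds, and `D` is
  -- chosen so that `1 ≤ D` and `R^2 ≤ m₀ D`.
  refine ⟨_, fun M hM f₀ hf₀ Ω _ P _ X hind hX =>
    SpikeSlab.tendstoInMeasure_posteriorBall (Γ := 512 * m₁ / m₀ ^ 2 + 16 * (5 + 2 * κ) / m₀)
      (D := 1 + R ^ 2 / m₀) hm₀ hm₁ hα hα1 hR hf₀.2 hf₀.1 ha hκ ?_ ?_ ?_ ?_ hM hind hX⟩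
  · exact le_add_of_nonneg_right (by positivity)
  · exact le_add_of_nonneg_left (by positivity)
  · exact le_add_of_nonneg_right (by positivity)
  · rw [mul_add, mul_div_cancel₀ _ hm₀.ne']
    linarith
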